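/- For $m\in\mathbb{N}_0$ let $(a;q)_m=\prod_{j=0}^{m-1}(1-aq^j)$, and let $$\tilde P_n(x;\alpha,\beta,\gamma;q)=\frac{(\alpha q;q)_n(\gamma q;q)_n}{(\alpha\beta q^{n+1};q)_n}\sum_{m=0}^{n}\frac{(q^{-n};q)_m(\alpha\beta q^{n+1};q)_m(x;q)_m}{(\alpha q;q)_m(\gamma q;q)_m}\,\frac{q^m}{(q;q)_m}$$ be the (monic) big $q$-Jacobi polynomials. **Theorem.** Let $0<q<1$, let $\alpha,\beta,\gamma\in\mathbb{R}$ with $0<\alpha q<1$, $0<\beta q<1$ and $\gamma<0$, and let $n\ge 2$ be an integer. The polynomials $\tilde P_n(x;\alpha,\beta,\gamma;q)$ and $\tilde P_{n-1}(x;\alpha,\beta,\gamma;q)$ have degrees $n$ and $n-1$ and only real, simple zeros $x_{n,1}<\cdots<x_{n,n}$ and $x_{n-1,1}<\cdots<x_{n-1,n-1}$, respectively, and the following hold. (i) If $\alpha>1$, then $\tilde P_n(x;\frac{\alpha}{q},\beta,\gamma;q)$ has degree $n$ and only real, simple zeros $y_{n,1}<\cdots<y_{n,n}$, and $$\gamma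 q<x_{n,1}<y_{n,1}<x_{n-1,1}<x_{n,2}<y_{n,2}<x_{n-1,2}<\cdots<x_{n-1,n-1}<x_{n,n}<y_{n,n}.$$ (ii) If $\beta>1$, then $\tilde P_n(x;\alpha,\frac{\beta}{q},\gamma;q)$ has degree $n$ and only real, simple zeros $z_{n,1}<\cdots<z_{n,n}$, and $$z_{n,1}<\gamma q<x_{n,1}<x_{n-1,1}<z_{n,2}<x_{n,2}<\cdots<x_{n-1,n-1}<z_{n,n}<x_{n,n}<\alpha q.$$ (iii) If $\beta>1$, then $\tilde P_n(x;\alpha,\frac{\beta}{q},\frac{\gamma}{q};q)$ has degree $n$ and only real, simple zeros $w_{n,1}<\cdots<w_{n,n}$, and $$w_{n,1}<x_{n,1}<x_{n-1,1}<w_{n,2}<x_{n,2}<\cdots<x_{n-1,n-1}<w_{n,n}<x_{n,n}<\alpha q.$$ (iv) If $\alpha>1$, $\beta>1$ and $n\ge 3$, then $\tilde P_n(x;\frac{\alpha}{q},\frac{\beta}{q},\gamma;q)$ has degree $n$ and all its zeros $v_{n,1}<\cdots<v_{n,n}$ are real and distinct, and $v_{n,1}<\gamma q$. -/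

import Mathlib

open Polynomial

noncomputable section

/-- The `q`-shifted factorial `(a; q)_m = ∏_{j=0}^{m-1} (1 - a q^j)` in a commutative ring. -/
def qPochhammer {R : Type*} [CommRing R] (a q : R) (m : ℕ) : R :=
  ∏ j ∈ Finset.range m, (1 - a * q ^ j)

/-- The monic big `q`-Jacobi polynomial
`((αq;q)_n (γq;q)_n / (αβq^{n+1};q)_n) * ₃φ₂(q^{-n}, αβq^{n+1}, x; αq, γq; q, q)`
as a real polynomial in `x`. The basic hypergeometric series is written as a finite sum, since
`(q^{-n}; q)_m = 0` for `m > n`; its factor `(-1)^m q^(m choose 2)` carries the exponent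
`1 + 2 - 3 = 0`. -/
def bigQJacobi (n : ℕ) (α β γ q : ℝ) : ℝ[X] :=
  C (qPochhammer (α * q) q n * qPochhammer (γ * q) q n /
      qPochhammer (α * β * q ^ (n + 1)) q n) *
    ∑ m ∈ Finset.range (n + 1),
      C (qPochhammer ((q ^ n)⁻¹) q m * qPochhammer (α * β * q ^ (n + 1)) q m /
          (qPochhammer (α * q) q m * qPochhammer (γ * q) q m) *
          (q ^ m / qPochhammer q q m)) *
        qPochhammer X (C q) m

/-- The polynomial `p` has degree `n`, and `x 1 < x 2 < ⋯ < x n` is the increasing list of all its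
zeros; in particular its zeros are all real and simple. Only the values `x 1, …, x n` matter. -/
def IsZeroList (p : ℝ[X]) (n : ℕ) (x : ℕ → ℝ) : Prop :=
  p.natDegree = n ∧ StrictMonoOn x (Set.Icc 1 n) ∧
    ∀ t : ℝ, p.IsRoot t ↔ ∃ j ∈ Set.Icc 1 n, x j = t

end

/-! With `a = αq`, `c = γq`, `s = αβq`, the polynomials `P_n` satisfy a recurrence
`P_{n+1} = (X - b) P_n - l P_{n-1}` with `l > 0` and have known values at `a` and `c`, so the zeros
of consecutive ones interlace inside `(c, a)`. Each of the shifts in (i)-(iii) turns `P_n` into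
`P_n + k P_{n-1}`, which agrees with `P_n` at the zeros of `P_{n-1}` and has the sign of
`k P_{n-1}` at the zeros of `P_n`; the sign of `k` decides which way the zeros move. When both `α`
and `β` are divided by `q`, one gets a combination of `P_n`, `P_{n-1}` and `P_{n-2}`, which by the
recurrence is still a positive multiple of `P_n` at the zeros of `P_{n-1}`. The value at `c` is a
product in which a single factor changes its sign when `β > 1`, and this pushes the smallest zero
below `c`. -/

noncomputable section

section QPochhammer

variable {R : Type*} [CommRing R]

@[simp] theorem qPochhammer_zero (a q : R) : qPochhammer a q 0 = 1 := by
  simp only [qPochhammer, Finset.range_zero, Finset.prod_empty]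

theorem qPochhammer_succ (a q : R) (m : ℕ) :
    qPochhammer a q (m + 1) = qPochhammer a q m * (1 - a * q ^ m) :=
  Finset.prod_range_succ _ _

theorem qPochhammer_succ' (a q : R) (m : ℕ) :
    qPochhammer a q (m + 1) = (1 - a) * qPochhammer (a * q) q m := by
  simp only [qPochhammer, Finset.prod_range_succ', pow_zero, mul_one, pow_succ', mul_assoc,
    mul_comm]

theorem one_sub_mul_qPochhammer_mul (a q : R) (m : ℕ) :
    (1 - a) * qPochhammer (a * q) q m = (1 - a * q ^ m) * qPochhammer a q m := by
  rw [← qPochhammer_succ', qPochhammer_succ, mul_comm]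

theorem qPochhammer_ne_zero [IsDomain R] {a q : R} (h : ∀ j, a * q ^ j ≠ 1) (m : ℕ) :
    qPochhammer a q m ≠ 0 :=
  Finset.prod_ne_zero_iff.2 fun j _ => sub_ne_zero.2 (h j).symm

theorem qPochhammer_self_ne_zero [IsDomain R] {q : R} (h : ∀ j, q ^ (j + 1) ≠ 1) (m : ℕ) :
    qPochhammer q q m ≠ 0 :=
  qPochhammer_ne_zero (fun j => pow_succ' q j ▸ h j) m

theorem qPochhammer_pos [LinearOrder R] [IsStrictOrderedRing R] {a q : R}
    (h : ∀ j, a * q ^ j < 1) (m : ℕ) : 0 < qPochhammer a q m :=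
  Finset.prod_pos fun j _ => sub_pos.2 (h j)

end QPochhammer

section Field

variable {K : Type*} [Field K] {q : K}

theorem qPochhammer_inv_pow_eq_zero (hq : q ≠ 0) {n m : ℕ} (h : n < m) :
    qPochhammer ((q ^ n)⁻¹) q m = 0 :=
  Finset.prod_eq_zero (Finset.mem_range.2 h) <| by
    rw [inv_mul_cancel₀ (pow_ne_zero n hq), sub_self]

theorem qPochhammer_inv_pow_succ (hq : q ≠ 0) (n m : ℕ) :
    qPochhammer ((q ^ (n + 1))⁻¹) q (m + 1) =
      (1 - (q ^ (n + 1))⁻¹) * qPochhammer ((q ^ n)⁻¹) q m := by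
  rw [qPochhammer_succ', pow_succ, mul_inv, inv_mul_cancel_right₀ hq]

theorem qPochhammer_inv_pow_pred (hq : q ≠ 0) (n m : ℕ) :
    (1 - q ^ (n + 1)) * qPochhammer ((q ^ n)⁻¹) q m =
      (q ^ m - q ^ (n + 1)) * qPochhammer ((q ^ (n + 1))⁻¹) q m := by
  have h := one_sub_mul_qPochhammer_mul ((q ^ (n + 1))⁻¹) q m
  have hn : q ^ (n + 1) * (q ^ (n + 1))⁻¹ = 1 := mul_inv_cancel₀ (pow_ne_zero _ hq)
  rw [pow_succ, mul_inv, inv_mul_cancel_right₀ hq, ← mul_inv, ← pow_succ] at h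
  linear_combination (-q ^ (n + 1)) * h + (-qPochhammer ((q ^ n)⁻¹) q m +
    q ^ m * qPochhammer ((q ^ (n + 1))⁻¹) q m) * hn

theorem qPochhammer_inv_pow_self_mul_prod_neg_pow (hq : q ≠ 0) (n : ℕ) :
    qPochhammer ((q ^ n)⁻¹) q n * q ^ n * ∏ j ∈ Finset.range n, -q ^ j = qPochhammer q q n := by
  induction n with
  | zero => simp
  | succ n ih =>
    rw [qPochhammer_inv_pow_succ hq, Finset.prod_range_succ, qPochhammer_succ q, ← ih]
    field_simp
    ring

section ChuVandermonde

/-- The terms of the terminating series `₂φ₁(q^{-n}, b; a; q, q)`. -/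
def phi21Term (q a b : K) (n m : ℕ) : K :=
  qPochhammer ((q ^ n)⁻¹) q m * qPochhammer b q m / qPochhammer a q m * (q ^ m / qPochhammer q q m)

variable {a : K}

theorem phi21Term_zero_right (q a b : K) (n : ℕ) : phi21Term q a b n 0 = 1 := by
  simp [phi21Term]

theorem phi21Term_eq_zero (hq : q ≠ 0) {n m : ℕ} (h : n < m) (a b : K) :
    phi21Term q a b n m = 0 := by
  simp [phi21Term, qPochhammer_inv_pow_eq_zero hq h]

theorem phi21Term_succ_succ (hq : q ≠ 0) (hq1 : ∀ j, q ^ (j + 1) ≠ 1) (ha : ∀ j, a * q ^ j ≠ 1)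
    (b : K) (n m : ℕ) :
    phi21Term q a b (n + 1) (m + 1) = phi21Term q a b n (m + 1) -
      (q ^ n)⁻¹ * ((1 - b) / (1 - a)) * phi21Term q (a * q) (b * q) n m := by
  have ha0 : 1 - a ≠ 0 := sub_ne_zero.2 (by simpa using (ha 0).symm)
  have haq : qPochhammer (a * q) q m ≠ 0 :=
    qPochhammer_ne_zero (fun j => by simpa only [pow_succ', mul_assoc] using ha (j + 1)) m
  have hqm := qPochhammer_self_ne_zero hq1 m
  have hm : 1 - q ^ (m + 1) ≠ 0 := sub_ne_zero.2 (hq1 m).symm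
  simp only [phi21Term]
  rw [qPochhammer_inv_pow_succ hq, qPochhammer_succ ((q ^ n)⁻¹), qPochhammer_succ' b,
    qPochhammer_succ' a, qPochhammer_succ q, ← pow_succ']
  generalize qPochhammer (a * q) q m = A at *
  generalize qPochhammer q q m = Z at *
  field_simp
  ring

/-- The `q`-Chu–Vandermonde summation; `∏ (b - a q^j)` is `b ^ n (a / b; q)_n` made total. -/
theorem sum_phi21Term (hq : q ≠ 0) (hq1 : ∀ j, q ^ (j + 1) ≠ 1) (ha : ∀ j, a * q ^ j ≠ 1)
    (b : K) (n : ℕ) :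
    ∑ m ∈ Finset.range (n + 1), phi21Term q a b n m =
      (∏ j ∈ Finset.range n, (b - a * q ^ j)) / qPochhammer a q n := by
  induction n generalizing a b with
  | zero => simp [phi21Term_zero_right]
  | succ n ih =>
    have haq : ∀ j, a * q * q ^ j ≠ 1 := fun j => by
      simpa only [pow_succ', mul_assoc] using ha (j + 1)
    have ha0 : 1 - a ≠ 0 := sub_ne_zero.2 (by simpa using (ha 0).symm)
    have split : ∑ m ∈ Finset.range (n + 2), phi21Term q a b (n + 1) m =
        ∑ m ∈ Finset.range (n + 1), phi21Term q a b n m - (q ^ n)⁻¹ * ((1 - b) / (1 - a)) *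
          ∑ m ∈ Finset.range (n + 1), phi21Term q (a * q) (b * q) n m := by
      have extend := Finset.sum_range_succ (phi21Term q a b n) (n + 1)
      rw [phi21Term_eq_zero hq n.lt_add_one, add_zero] at extend
      rw [← extend, Finset.sum_range_succ', Finset.sum_range_succ' (phi21Term q a b n),
        Finset.sum_congr rfl fun m _ => phi21Term_succ_succ hq hq1 ha b n m,
        Finset.sum_sub_distrib, ← Finset.mul_sum, phi21Term_zero_right, phi21Term_zero_right]
      ring
    have scaled : ∏ j ∈ Finset.range n, (b * q - a * q * q ^ j) =
        q ^ n * ∏ j ∈ Finset.range n, (b - a * q ^ j) := by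
      rw [Finset.prod_congr rfl fun j _ =>
        show b * q - a * q * q ^ j = q * (b - a * q ^ j) by ring, Finset.prod_mul_distrib,
        Finset.prod_const, Finset.card_range]
    have shift : qPochhammer (a * q) q n = (1 - a * q ^ n) * qPochhammer a q n / (1 - a) := by
      rw [eq_div_iff ha0, mul_comm, one_sub_mul_qPochhammer_mul]
    have hA := qPochhammer_ne_zero ha n
    have hn : 1 - a * q ^ n ≠ 0 := sub_ne_zero.2 (ha n).symm
    rw [split, ih ha, ih haq, scaled, shift, Finset.prod_range_succ, qPochhammer_succ]
    field_simp
    ring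

end ChuVandermonde

section Phi

variable {a c s : K}

/-- The coefficient of `(x; q)_m` in `₃φ₂(q^{-n}, s q^n, x; a, c; q, q)`. The big `q`-Jacobi
polynomials are the case `a = αq`, `c = γq`, `s = αβq`, in which `a` and `c` play symmetric
roles. -/
def phiCoeff (q a c s : K) (n m : ℕ) : K :=
  qPochhammer ((q ^ n)⁻¹) q m * qPochhammer (s * q ^ n) q m /
    (qPochhammer a q m * qPochhammer c q m) * (q ^ m / qPochhammer q q m)

/-- The factor that makes `₃φ₂(q^{-n}, s q^n, x; a, c; q, q)` monic. -/
def phiScale (q a c s : K) (n : ℕ) : K :=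
  qPochhammer a q n * qPochhammer c q n / qPochhammer (s * q ^ n) q n

/-- The polynomial `₃φ₂(q^{-n}, s q^n, x; a, c; q, q)`, normalized to the value `1` at `x = 1`. -/
def phiPoly (q a c s : K) (n : ℕ) : K[X] :=
  ∑ m ∈ Finset.range (n + 1), C (phiCoeff q a c s n m) * qPochhammer X (C q) m

/-- The monic multiple of `phiPoly`. -/
def monicPhi (q a c s : K) (n : ℕ) : K[X] :=
  C (phiScale q a c s n) * phiPoly q a c s n

theorem phiCoeff_swap (q a c s : K) (n m : ℕ) : phiCoeff q c a s n m = phiCoeff q a c s n m := by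
  simp only [phiCoeff, mul_comm]

theorem phiScale_swap (q a c s : K) (n : ℕ) : phiScale q c a s n = phiScale q a c s n := by
  simp only [phiScale, mul_comm]

theorem monicPhi_swap (q a c s : K) (n : ℕ) : monicPhi q c a s n = monicPhi q a c s n := by
  simp only [monicPhi, phiPoly, phiScale_swap q a c, phiCoeff_swap q a c]

theorem phiCoeff_zero_right (q a c s : K) (n : ℕ) : phiCoeff q a c s n 0 = 1 := by
  simp [phiCoeff]

theorem phiCoeff_eq_zero (hq : q ≠ 0) {n m : ℕ} (h : n < m) (a c s : K) :
    phiCoeff q a c s n m = 0 := by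
  simp [phiCoeff, qPochhammer_inv_pow_eq_zero hq h]

theorem phiPoly_eq_sum (hq : q ≠ 0) {n N : ℕ} (h : n < N) (a c s : K) :
    phiPoly q a c s n =
      ∑ m ∈ Finset.range N, C (phiCoeff q a c s n m) * qPochhammer X (C q) m :=
  Finset.sum_subset (Finset.range_subset_range.2 h) fun m _ hm => by
    rw [phiCoeff_eq_zero hq (by simpa using hm), C_0, zero_mul]

theorem monicPhi_eq_sum (hq : q ≠ 0) {n N : ℕ} (h : n < N) (a c s : K) :
    monicPhi q a c s n = ∑ m ∈ Finset.range N,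
      C (phiScale q a c s n * phiCoeff q a c s n m) * qPochhammer X (C q) m := by
  simp only [monicPhi, phiPoly_eq_sum hq h, Finset.mul_sum, C_mul, mul_assoc]

theorem monicPhi_zero (q a c s : K) : monicPhi q a c s 0 = 1 := by
  simp [monicPhi, phiPoly, phiScale, phiCoeff_zero_right]

theorem qPochhammer_X_eq_mul_prod (hq : q ≠ 0) (m : ℕ) :
    qPochhammer (X : K[X]) (C q) m =
      C (∏ j ∈ Finset.range m, -q ^ j) * ∏ j ∈ Finset.range m, (X - C ((q ^ j)⁻¹)) := by
  rw [map_prod, ← Finset.prod_mul_distrib]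
  refine Finset.prod_congr rfl fun j _ => ?_
  rw [mul_sub, ← C_mul, neg_mul, mul_inv_cancel₀ (pow_ne_zero j hq)]
  simp only [C_neg, C_pow, C_1]
  ring

theorem phiScale_mul_phiCoeff_self (hq : q ≠ 0) (hq1 : ∀ j, q ^ (j + 1) ≠ 1)
    (ha : ∀ j, a * q ^ j ≠ 1) (hc : ∀ j, c * q ^ j ≠ 1) {n : ℕ}
    (hs : ∀ j, s * q ^ n * q ^ j ≠ 1) :
    phiScale q a c s n * phiCoeff q a c s n n * ∏ j ∈ Finset.range n, -q ^ j = 1 := by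
  have hA := qPochhammer_ne_zero ha n
  have hC := qPochhammer_ne_zero hc n
  have hS := qPochhammer_ne_zero hs n
  have hQ := qPochhammer_self_ne_zero hq1 n
  have reversal := qPochhammer_inv_pow_self_mul_prod_neg_pow hq n
  rw [phiScale, phiCoeff]
  generalize qPochhammer ((q ^ n)⁻¹) q n = N at *
  field_simp
  linear_combination reversal

theorem monicPhi_eq_prod_add (hq : q ≠ 0) (hq1 : ∀ j, q ^ (j + 1) ≠ 1)
    (ha : ∀ j, a * q ^ j ≠ 1) (hc : ∀ j, c * q ^ j ≠ 1) {n : ℕ}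
    (hs : ∀ j, s * q ^ n * q ^ j ≠ 1) :
    ∃ r : K[X], r.degree < n ∧
      monicPhi q a c s n = ∏ j ∈ Finset.range n, (X - C ((q ^ j)⁻¹)) + r := by
  refine ⟨∑ m ∈ Finset.range n,
    C (phiScale q a c s n * phiCoeff q a c s n m) * qPochhammer X (C q) m, ?_, ?_⟩
  · refine mem_degreeLT.1 (sum_mem fun m hm => mem_degreeLT.2 ?_)
    rw [qPochhammer_X_eq_mul_prod hq, ← mul_assoc, ← C_mul, ← smul_eq_C_mul]
    refine (degree_smul_le _ _).trans_lt ?_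
    simpa [degree_prod] using hm
  · rw [monicPhi_eq_sum hq n.lt_add_one, Finset.sum_range_succ, add_comm,
      qPochhammer_X_eq_mul_prod hq n, ← mul_assoc, ← C_mul,
      phiScale_mul_phiCoeff_self hq hq1 ha hc hs, C_1, one_mul]

theorem monic_monicPhi (hq : q ≠ 0) (hq1 : ∀ j, q ^ (j + 1) ≠ 1)
    (ha : ∀ j, a * q ^ j ≠ 1) (hc : ∀ j, c * q ^ j ≠ 1) {n : ℕ}
    (hs : ∀ j, s * q ^ n * q ^ j ≠ 1) : (monicPhi q a c s n).Monic := by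
  obtain ⟨r, hr, h⟩ := monicPhi_eq_prod_add hq hq1 ha hc hs
  rw [h]
  exact (monic_prod_X_sub_C _ _).add_of_left (by simpa [degree_prod] using hr)

theorem natDegree_monicPhi (hq : q ≠ 0) (hq1 : ∀ j, q ^ (j + 1) ≠ 1)
    (ha : ∀ j, a * q ^ j ≠ 1) (hc : ∀ j, c * q ^ j ≠ 1) {n : ℕ}
    (hs : ∀ j, s * q ^ n * q ^ j ≠ 1) : (monicPhi q a c s n).natDegree = n := by
  obtain ⟨r, hr, h⟩ := monicPhi_eq_prod_add hq hq1 ha hc hs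
  rw [h, natDegree_add_eq_left_of_degree_lt (by simpa [degree_prod] using hr),
    natDegree_finsetProd_X_sub_C_eq_card, Finset.card_range]

theorem eval_monicPhi_right (hq : q ≠ 0) (hq1 : ∀ j, q ^ (j + 1) ≠ 1) (ha : ∀ j, a * q ^ j ≠ 1)
    (hc : ∀ j, c * q ^ j ≠ 1) (s : K) (n : ℕ) :
    (monicPhi q a c s n).eval c =
      qPochhammer c q n * (∏ j ∈ Finset.range n, (s * q ^ n - a * q ^ j)) /
        qPochhammer (s * q ^ n) q n := by
  have eval_qPochhammer (m : ℕ) : (qPochhammer (X : K[X]) (C q) m).eval c = qPochhammer c q m := by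
    simp [qPochhammer, eval_prod]
  have cancel (m : ℕ) : phiCoeff q a c s n m * qPochhammer c q m =
      phi21Term q a (s * q ^ n) n m := by
    have := qPochhammer_ne_zero hc m
    rw [phiCoeff, phi21Term]
    field_simp
  have hA := qPochhammer_ne_zero ha n
  simp only [monicPhi, phiPoly, eval_mul, eval_C, eval_finsetSum, eval_qPochhammer, cancel,
    sum_phi21Term hq hq1 ha, phiScale]
  field_simp

theorem eval_monicPhi_left (hq : q ≠ 0) (hq1 : ∀ j, q ^ (j + 1) ≠ 1) (ha : ∀ j, a * q ^ j ≠ 1)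
    (hc : ∀ j, c * q ^ j ≠ 1) (s : K) (n : ℕ) :
    (monicPhi q a c s n).eval a =
      qPochhammer a q n * (∏ j ∈ Finset.range n, (s * q ^ n - c * q ^ j)) /
        qPochhammer (s * q ^ n) q n := by
  rw [← monicPhi_swap, eval_monicPhi_right hq hq1 hc ha]

theorem one_sub_mul_phiCoeff_mul_left (ha : ∀ j, a * q ^ j ≠ 1) (c s : K) (n m : ℕ) :
    (1 - a * q ^ m) * phiCoeff q (a * q) c s n m = (1 - a) * phiCoeff q a c s n m := by
  have haq : ∀ j, a * q * q ^ j ≠ 1 := fun j => by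
    simpa only [pow_succ', mul_assoc] using ha (j + 1)
  have shift : (1 - a * q ^ m) / qPochhammer (a * q) q m = (1 - a) / qPochhammer a q m := by
    rw [div_eq_div_iff (qPochhammer_ne_zero haq m) (qPochhammer_ne_zero ha m),
      one_sub_mul_qPochhammer_mul]
  simp only [phiCoeff]
  linear_combination (qPochhammer ((q ^ n)⁻¹) q m * qPochhammer (s * q ^ n) q m /
    qPochhammer c q m * (q ^ m / qPochhammer q q m)) * shift

theorem one_sub_mul_phiCoeff_mul (q a c s : K) (n m : ℕ) :
    (1 - s * q ^ n) * phiCoeff q a c (s * q) n m =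
      (1 - s * q ^ n * q ^ m) * phiCoeff q a c s n m := by
  have shift := one_sub_mul_qPochhammer_mul (s * q ^ n) q m
  simp only [phiCoeff, mul_right_comm s q]
  linear_combination (qPochhammer ((q ^ n)⁻¹) q m / (qPochhammer a q m * qPochhammer c q m) *
    (q ^ m / qPochhammer q q m)) * shift

theorem one_sub_mul_phiCoeff_pred (hq : q ≠ 0) (a c s : K) (n m : ℕ) :
    (1 - q ^ (n + 1)) * phiCoeff q a c (s * q) n m =
      (q ^ m - q ^ (n + 1)) * phiCoeff q a c s (n + 1) m := by
  have lower := qPochhammer_inv_pow_pred hq n m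
  simp only [phiCoeff, mul_assoc s q, ← pow_succ']
  linear_combination (qPochhammer (s * q ^ (n + 1)) q m /
    (qPochhammer a q m * qPochhammer c q m) * (q ^ m / qPochhammer q q m)) * lower

theorem one_sub_mul_phiScale_mul_left (q a c s : K) (n : ℕ) :
    (1 - a) * phiScale q (a * q) c s n = (1 - a * q ^ n) * phiScale q a c s n := by
  have shift := one_sub_mul_qPochhammer_mul a q n
  simp only [phiScale]
  linear_combination (qPochhammer c q n / qPochhammer (s * q ^ n) q n) * shift

theorem one_sub_mul_phiScale_mul {n : ℕ} (hs : ∀ j, s * q ^ n * q ^ j ≠ 1) (a c : K) :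
    (1 - s * q ^ n * q ^ n) * phiScale q a c (s * q) n = (1 - s * q ^ n) * phiScale q a c s n := by
  have hsq : ∀ j, s * q ^ n * q * q ^ j ≠ 1 := fun j => by
    simpa only [pow_succ', mul_assoc] using hs (j + 1)
  have shift : (1 - s * q ^ n * q ^ n) / qPochhammer (s * q ^ n * q) q n =
      (1 - s * q ^ n) / qPochhammer (s * q ^ n) q n := by
    rw [div_eq_div_iff (qPochhammer_ne_zero hsq n) (qPochhammer_ne_zero hs n),
      one_sub_mul_qPochhammer_mul]
  simp only [phiScale, mul_right_comm s q]
  linear_combination (qPochhammer a q n * qPochhammer c q n) * shift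

theorem phiScale_succ (q a c s : K) (n : ℕ) :
    phiScale q a c s (n + 1) = (1 - a * q ^ n) * (1 - c * q ^ n) / (1 - s * q ^ (2 * n + 1)) *
      phiScale q a c (s * q) n := by
  simp only [phiScale, qPochhammer_succ, mul_assoc s, ← pow_succ', ← pow_add]
  rw [show n + 1 + n = 2 * n + 1 by ring]
  simp only [div_eq_mul_inv, mul_inv]
  ring

/-- The coefficient of `(x; q)_m` in `monicPhi q a c s n`. -/
def monicPhiCoeff (q a c s : K) (n m : ℕ) : K :=
  phiScale q a c s n * phiCoeff q a c s n m

theorem one_sub_mul_monicPhiCoeff_mul_left (ha : ∀ j, a * q ^ j ≠ 1) (c s : K) (n m : ℕ) :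
    (1 - a * q ^ m) * monicPhiCoeff q (a * q) c s n m =
      (1 - a * q ^ n) * monicPhiCoeff q a c s n m := by
  refine mul_left_cancel₀ (sub_ne_zero.2 (by simpa using (ha 0).symm) : 1 - a ≠ 0) ?_
  simp only [monicPhiCoeff]
  linear_combination (1 - a) * phiScale q (a * q) c s n * one_sub_mul_phiCoeff_mul_left ha c s n m +
    (1 - a) * phiCoeff q a c s n m * one_sub_mul_phiScale_mul_left q a c s n

theorem one_sub_mul_monicPhiCoeff_mul {n : ℕ} (hs : ∀ j, s * q ^ n * q ^ j ≠ 1) (a c : K) (m : ℕ) :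
    (1 - s * q ^ n * q ^ n) * monicPhiCoeff q a c (s * q) n m =
      (1 - s * q ^ n * q ^ m) * monicPhiCoeff q a c s n m := by
  refine mul_left_cancel₀ (sub_ne_zero.2 (by simpa using (hs 0).symm) : 1 - s * q ^ n ≠ 0) ?_
  simp only [monicPhiCoeff]
  linear_combination (1 - s * q ^ n) * phiCoeff q a c (s * q) n m *
      one_sub_mul_phiScale_mul hs a c +
    (1 - s * q ^ n) * phiScale q a c s n * one_sub_mul_phiCoeff_mul q a c s n m

theorem one_sub_mul_monicPhiCoeff_pred (hq : q ≠ 0) {n : ℕ}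
    (hs : s * q ^ (2 * n + 1) ≠ 1) (a c : K) (m : ℕ) :
    (1 - q ^ (n + 1)) * (1 - a * q ^ n) * (1 - c * q ^ n) * monicPhiCoeff q a c (s * q) n m =
      (1 - s * q ^ (2 * n + 1)) * (q ^ m - q ^ (n + 1)) * monicPhiCoeff q a c s (n + 1) m := by
  have hs' : 1 - s * q ^ (2 * n + 1) ≠ 0 := sub_ne_zero.2 hs.symm
  simp only [monicPhiCoeff, phiScale_succ]
  field_simp
  linear_combination (1 - a * q ^ n) * (1 - c * q ^ n) * phiScale q a c (s * q) n *
    one_sub_mul_phiCoeff_pred hq a c s n m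

theorem monicPhi_add_C_mul_eq (hq : q ≠ 0) {a' c' s' k : K} {n : ℕ}
    (h : ∀ m, monicPhiCoeff q a c s (n + 1) m =
      monicPhiCoeff q a' c' s' (n + 1) m + k * monicPhiCoeff q a' c' s' n m) :
    monicPhi q a c s (n + 1) = monicPhi q a' c' s' (n + 1) + C k * monicPhi q a' c' s' n := by
  rw [monicPhi_eq_sum hq (by lia : n + 1 < n + 2), monicPhi_eq_sum hq (by lia : n + 1 < n + 2),
    monicPhi_eq_sum hq (by lia : n < n + 2), Finset.mul_sum, ← Finset.sum_add_distrib]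
  refine Finset.sum_congr rfl fun m _ => ?_
  rw [← mul_assoc, ← C_mul, ← add_mul, ← C_add]
  exact congrArg (C · * _) (h m)

theorem monicPhi_eq_add_mul (hq : q ≠ 0) {n : ℕ}
    (hs : ∀ j, s * q ^ (n + 1) * q ^ j ≠ 1) (a c : K) :
    monicPhi q a c s (n + 1) = monicPhi q a c (s * q) (n + 1) +
      C (s * q ^ (n + 1) * (1 - q ^ (n + 1)) * (1 - a * q ^ n) * (1 - c * q ^ n) /
        ((1 - s * q ^ (2 * n + 1)) * (1 - s * q ^ (2 * n + 2)))) * monicPhi q a c (s * q) n := by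
  refine monicPhi_add_C_mul_eq hq fun m => ?_
  have hs1 : s * q ^ (2 * n + 1) ≠ 1 := by convert hs n using 1; ring
  have hs2 : s * q ^ (2 * n + 2) ≠ 1 := by convert hs (n + 1) using 1; ring
  have same := one_sub_mul_monicPhiCoeff_mul hs a c m
  have pred := one_sub_mul_monicPhiCoeff_pred hq hs1 a c m
  have hs1' := sub_ne_zero.2 hs1.symm
  have hs2' := sub_ne_zero.2 hs2.symm
  rw [show s * q ^ (n + 1) * q ^ (n + 1) = s * q ^ (2 * n + 2) by ring] at same
  refine mul_left_cancel₀ hs2' ?_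
  rw [mul_add, same]
  field_simp
  linear_combination (-s * q ^ (n + 1)) * pred

theorem monicPhi_eq_add_mul_left (hq : q ≠ 0) (ha : ∀ j, a * q ^ j ≠ 1) {n : ℕ}
    (hs : ∀ j, s * q ^ (n + 1) * q ^ j ≠ 1) (c : K) :
    monicPhi q a c s (n + 1) = monicPhi q (a * q) c (s * q) (n + 1) +
      C (-((1 - q ^ (n + 1)) * (a - s * q ^ (n + 1)) * (1 - c * q ^ n)) /
        ((1 - s * q ^ (2 * n + 1)) * (1 - s * q ^ (2 * n + 2)))) *
          monicPhi q (a * q) c (s * q) n := by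
  refine monicPhi_add_C_mul_eq hq fun m => ?_
  have hs1 : s * q ^ (2 * n + 1) ≠ 1 := by convert hs n using 1; ring
  have hs2 : s * q ^ (2 * n + 2) ≠ 1 := by convert hs (n + 1) using 1; ring
  have same := one_sub_mul_monicPhiCoeff_mul hs a c m
  have pred := one_sub_mul_monicPhiCoeff_pred hq hs1 a c m
  have left := one_sub_mul_monicPhiCoeff_mul_left ha c (s * q) (n + 1) m
  have left' := one_sub_mul_monicPhiCoeff_mul_left ha c (s * q) n m
  have ham := sub_ne_zero.2 (ha m).symm
  have hs1' := sub_ne_zero.2 hs1.symm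
  have hs2' := sub_ne_zero.2 hs2.symm
  rw [show s * q ^ (n + 1) * q ^ (n + 1) = s * q ^ (2 * n + 2) by ring] at same
  refine mul_left_cancel₀ ham ?_
  rw [mul_add, left, mul_left_comm, left']
  field_simp
  linear_combination (a - s * q ^ (n + 1)) * pred -
    (1 - s * q ^ (2 * n + 1)) * (1 - a * q ^ (n + 1)) * same

theorem one_sub_mul_div_qPochhammer_succ {m : ℕ} (hm : q ^ (m + 1) ≠ 1) :
    (1 - q ^ (m + 1)) * (q ^ (m + 1) / qPochhammer q q (m + 1)) =
      q * (q ^ m / qPochhammer q q m) := by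
  rw [qPochhammer_succ, ← pow_succ', ← div_div, mul_div_cancel₀ _ (sub_ne_zero.2 hm.symm),
    pow_succ', mul_div_assoc]

theorem one_sub_mul_phiCoeff_succ (a c s : K) (n : ℕ) {m : ℕ} (hm : q ^ (m + 1) ≠ 1) :
    (1 - q ^ (m + 1)) * phiCoeff q a c s n (m + 1) =
      (1 - (q ^ n)⁻¹ * q ^ m) * (1 - s * q ^ n * q ^ m) * q /
        ((1 - a * q ^ m) * (1 - c * q ^ m)) * phiCoeff q a c s n m := by
  rw [phiCoeff, mul_left_comm, one_sub_mul_div_qPochhammer_succ hm, phiCoeff]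
  simp only [qPochhammer_succ _ q m, div_eq_mul_inv, mul_inv]
  ring

theorem phiCoeff_succ_sub_phiCoeff (hq : q ≠ 0) (a c s : K) {m : ℕ} (hm : q ^ (m + 1) ≠ 1)
    (n : ℕ) :
    phiCoeff q a c s (n + 1) (m + 1) - phiCoeff q a c s n (m + 1) =
      -((1 - s * q ^ (2 * n + 1)) / (q ^ n * ((1 - a * q ^ m) * (1 - c * q ^ m)))) *
        phiCoeff q a c (s * q) n m := by
  have numerator : qPochhammer ((q ^ (n + 1))⁻¹) q (m + 1) *
        qPochhammer (s * q ^ (n + 1)) q (m + 1) -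
      qPochhammer ((q ^ n)⁻¹) q (m + 1) * qPochhammer (s * q ^ n) q (m + 1) =
      -((1 - s * q ^ (2 * n + 1)) * (1 - q ^ (m + 1)) / q ^ (n + 1)) *
        (qPochhammer ((q ^ n)⁻¹) q m * qPochhammer (s * q ^ (n + 1)) q m) := by
    rw [qPochhammer_inv_pow_succ hq, qPochhammer_succ (s * q ^ (n + 1)),
      qPochhammer_succ ((q ^ n)⁻¹), qPochhammer_succ' (s * q ^ n), mul_assoc s (q ^ n), ← pow_succ]
    generalize qPochhammer ((q ^ n)⁻¹) q m = A
    field_simp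
    ring
  have denominator := one_sub_mul_div_qPochhammer_succ hm
  have cancel : (q ^ (n + 1))⁻¹ * q = (q ^ n)⁻¹ := by
    rw [pow_succ, mul_inv, inv_mul_cancel_right₀ hq]
  simp only [phiCoeff, mul_assoc s q, ← pow_succ']
  rw [← sub_mul, ← sub_div, numerator, qPochhammer_succ a, qPochhammer_succ c]
  generalize qPochhammer ((q ^ n)⁻¹) q m = N
  simp only [div_eq_mul_inv, mul_inv] at denominator ⊢
  rw [← cancel]
  linear_combination (-(1 - s * q ^ (2 * n + 1)) * (q ^ (n + 1))⁻¹ *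
    (N * qPochhammer (s * q ^ (n + 1)) q m) *
    (qPochhammer a q m)⁻¹ * (qPochhammer c q m)⁻¹ * (1 - a * q ^ m)⁻¹ * (1 - c * q ^ m)⁻¹) *
      denominator

/-- The coefficient of `phiPoly q a c s (n + 1)` in the expansion of `(x - 1) * phiPoly q a c s n`
in the polynomials `phiPoly q a c s k`. -/
def phiUp (q a c s : K) (n : ℕ) : K :=
  (1 - a * q ^ n) * (1 - c * q ^ n) * (1 - s * q ^ n) /
    ((1 - s * q ^ (2 * n)) * (1 - s * q ^ (2 * n + 1)))

/-- The coefficient of `phiPoly q a c s n` in the expansion of `(x - 1) * phiPoly q a c s (n + 1)`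
in the polynomials `phiPoly q a c s k`. -/
def phiDown (q a c s : K) (n : ℕ) : K :=
  -(q ^ n * (1 - q ^ (n + 1)) * (a - s * q ^ (n + 1)) * (c - s * q ^ (n + 1))) /
    ((1 - s * q ^ (2 * n + 1)) * (1 - s * q ^ (2 * n + 2)))

theorem phiUp_succ_mul_phiCoeff_sub (hq : q ≠ 0) (hs : ∀ j, s * q ^ (j + 1) ≠ 1) (a c : K) (n : ℕ)
    {m : ℕ} (hm : q ^ (m + 1) ≠ 1) :
    phiUp q a c s (n + 1) *
        (phiCoeff q a c s (n + 2) (m + 1) - phiCoeff q a c s (n + 1) (m + 1)) =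
      -((1 - a * q ^ (n + 1)) * (1 - c * q ^ (n + 1)) * (1 - s * q ^ (n + 1) * q ^ m)) /
        (q ^ (n + 1) * (1 - s * q ^ (2 * n + 2)) * ((1 - a * q ^ m) * (1 - c * q ^ m))) *
        phiCoeff q a c s (n + 1) m := by
  have h := sub_ne_zero.2 (hs (2 * n + 2)).symm
  have up := one_sub_mul_phiCoeff_mul q a c s (n + 1) m
  rw [phiCoeff_succ_sub_phiCoeff hq a c s hm (n + 1), phiUp, mul_add_one 2 n]
  simp only [div_eq_mul_inv, mul_inv]
  linear_combination (norm := skip) (-((1 - a * q ^ (n + 1)) * (1 - c * q ^ (n + 1))) *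
    (q ^ (n + 1))⁻¹ * (1 - s * q ^ (2 * n + 2))⁻¹ * (1 - a * q ^ m)⁻¹ * (1 - c * q ^ m)⁻¹) * up
  generalize (1 - a * q ^ m)⁻¹ = A
  generalize (1 - c * q ^ m)⁻¹ = B
  generalize (1 - s * q ^ (2 * n + 2))⁻¹ = S
  field_simp
  ring

theorem phiDown_mul_phiCoeff_sub (hq : q ≠ 0) (hs : ∀ j, s * q ^ (j + 1) ≠ 1) (a c : K) (n : ℕ)
    {m : ℕ} (hm : q ^ (m + 1) ≠ 1) :
    phiDown q a c s n * (phiCoeff q a c s (n + 1) (m + 1) - phiCoeff q a c s n (m + 1)) =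
      (a - s * q ^ (n + 1)) * (c - s * q ^ (n + 1)) * (q ^ m - q ^ (n + 1)) /
        ((1 - s * q ^ (2 * n + 2)) * ((1 - a * q ^ m) * (1 - c * q ^ m))) *
        phiCoeff q a c s (n + 1) m := by
  have h := sub_ne_zero.2 (hs (2 * n)).symm
  have down := one_sub_mul_phiCoeff_pred hq a c s n m
  rw [phiCoeff_succ_sub_phiCoeff hq a c s hm n, phiDown]
  simp only [div_eq_mul_inv, mul_inv]
  linear_combination (norm := skip) ((a - s * q ^ (n + 1)) * (c - s * q ^ (n + 1)) *
    (1 - s * q ^ (2 * n + 2))⁻¹ * (1 - a * q ^ m)⁻¹ * (1 - c * q ^ m)⁻¹) * down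
  generalize (1 - a * q ^ m)⁻¹ = A
  generalize (1 - c * q ^ m)⁻¹ = B
  generalize (1 - s * q ^ (2 * n + 2))⁻¹ = S
  field_simp
  ring

theorem phiCoeff_recurrence (hq : q ≠ 0) (ha : ∀ j, a * q ^ j ≠ 1) (hc : ∀ j, c * q ^ j ≠ 1)
    (hs : ∀ j, s * q ^ (j + 1) ≠ 1) (n : ℕ) {m : ℕ} (hm : q ^ (m + 1) ≠ 1) :
    phiCoeff q a c s (n + 1) (m + 1) * ((q ^ (m + 1))⁻¹ - 1) -
        phiCoeff q a c s (n + 1) m * (q ^ m)⁻¹ =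
      phiUp q a c s (n + 1) *
          (phiCoeff q a c s (n + 2) (m + 1) - phiCoeff q a c s (n + 1) (m + 1)) -
        phiDown q a c s n *
          (phiCoeff q a c s (n + 1) (m + 1) - phiCoeff q a c s n (m + 1)) := by
  have left : phiCoeff q a c s (n + 1) (m + 1) * ((q ^ (m + 1))⁻¹ - 1) =
      (1 - q ^ (m + 1)) * phiCoeff q a c s (n + 1) (m + 1) / (q * q ^ m) := by
    rw [← pow_succ']
    field_simp
  have hs2 : 1 - (q ^ (n + 1)) ^ 2 * s ≠ 0 := by
    rw [← pow_mul, mul_comm _ s, mul_comm _ 2]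
    exact sub_ne_zero.2 (hs (2 * n + 1)).symm
  have ham : 1 - q ^ m * a ≠ 0 := mul_comm a _ ▸ sub_ne_zero.2 (ha m).symm
  have hcm : 1 - q ^ m * c ≠ 0 := mul_comm c _ ▸ sub_ne_zero.2 (hc m).symm
  have hqm := pow_ne_zero m hq
  have hqn := pow_ne_zero (n + 1) hq
  rw [left, one_sub_mul_phiCoeff_succ a c s (n + 1) hm,
    phiUp_succ_mul_phiCoeff_sub hq hs a c n hm, phiDown_mul_phiCoeff_sub hq hs a c n hm,
    show 2 * n + 2 = (n + 1) * 2 by ring, pow_mul]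
  generalize q ^ m = x at ham hcm hqm ⊢
  generalize q ^ (n + 1) = Q at hs2 hqn ⊢
  field_simp
  ring

theorem X_sub_one_mul_qPochhammer_X (hq : q ≠ 0) (m : ℕ) :
    (X - 1) * qPochhammer (X : K[X]) (C q) m =
      C ((q ^ m)⁻¹ - 1) * qPochhammer X (C q) m -
        C ((q ^ m)⁻¹) * qPochhammer X (C q) (m + 1) := by
  have inverse : C ((q ^ m)⁻¹) * C q ^ m = (1 : K[X]) := by
    rw [← C_pow, ← C_mul, inv_mul_cancel₀ (pow_ne_zero m hq), C_1]
  rw [qPochhammer_succ, C_sub, C_1]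
  linear_combination (-X * qPochhammer X (C q) m) * inverse

theorem X_sub_one_mul_sum_qPochhammer_X (hq : q ≠ 0) {f : ℕ → K} {N : ℕ} (hf : f N = 0) :
    (X - 1) * ∑ m ∈ Finset.range N, C (f m) * qPochhammer X (C q) m =
      ∑ m ∈ Finset.range N,
        C (f (m + 1) * ((q ^ (m + 1))⁻¹ - 1) - f m * (q ^ m)⁻¹) * qPochhammer X (C q) (m + 1) := by
  have shift := Finset.sum_range_succ' (fun m => C (f m * ((q ^ m)⁻¹ - 1)) *
    qPochhammer (X : K[X]) (C q) m) N
  rw [Finset.sum_range_succ, hf] at shift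
  simp only [zero_mul, C_0, add_zero, pow_zero, inv_one, sub_self, mul_zero] at shift
  rw [← sub_eq_zero] at shift
  rw [← sub_zero (_ * _), ← shift, Finset.mul_sum, ← Finset.sum_sub_distrib,
    ← Finset.sum_sub_distrib]
  refine Finset.sum_congr rfl fun m _ => ?_
  rw [mul_left_comm, X_sub_one_mul_qPochhammer_X hq]
  simp only [C_mul, C_sub]
  ring

theorem phiPoly_sub_phiPoly (hq : q ≠ 0) {n k N : ℕ} (hn : n ≤ N) (hk : k ≤ N) (a c s : K) :
    phiPoly q a c s n - phiPoly q a c s k = ∑ m ∈ Finset.range N,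
      C (phiCoeff q a c s n (m + 1) - phiCoeff q a c s k (m + 1)) *
        qPochhammer X (C q) (m + 1) := by
  rw [phiPoly_eq_sum hq (Nat.lt_succ_of_le hn), phiPoly_eq_sum hq (Nat.lt_succ_of_le hk),
    Finset.sum_range_succ', Finset.sum_range_succ', phiCoeff_zero_right, phiCoeff_zero_right,
    add_sub_add_right_eq_sub, ← Finset.sum_sub_distrib]
  simp only [C_sub, sub_mul]

theorem phiPoly_recurrence (hq : q ≠ 0) (hq1 : ∀ j, q ^ (j + 1) ≠ 1) (ha : ∀ j, a * q ^ j ≠ 1)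
    (hc : ∀ j, c * q ^ j ≠ 1) (hs : ∀ j, s * q ^ (j + 1) ≠ 1) (n : ℕ) :
    (X - 1) * phiPoly q a c s (n + 1) =
      C (phiUp q a c s (n + 1)) * (phiPoly q a c s (n + 2) - phiPoly q a c s (n + 1)) -
        C (phiDown q a c s n) * (phiPoly q a c s (n + 1) - phiPoly q a c s n) := by
  rw [phiPoly_sub_phiPoly hq (n := n + 2) (k := n + 1) le_rfl (n + 1).le_succ,
    phiPoly_sub_phiPoly hq (n + 1).le_succ (n.le_add_right 2), phiPoly,
    X_sub_one_mul_sum_qPochhammer_X hq (phiCoeff_eq_zero hq (n + 1).lt_succ_self a c s),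
    Finset.mul_sum, Finset.mul_sum, ← Finset.sum_sub_distrib]
  refine Finset.sum_congr rfl fun m _ => ?_
  rw [phiCoeff_recurrence hq ha hc hs n (hq1 m), ← mul_assoc, ← mul_assoc, ← sub_mul, C_sub, C_mul,
    C_mul]

theorem phiScale_ne_zero (ha : ∀ j, a * q ^ j ≠ 1) (hc : ∀ j, c * q ^ j ≠ 1)
    (hs : ∀ j, s * q ^ (j + 1) ≠ 1) (n : ℕ) : phiScale q a c s n ≠ 0 := by
  cases n with
  | zero => simp [phiScale]
  | succ n =>
    refine div_ne_zero (mul_ne_zero (qPochhammer_ne_zero ha _) (qPochhammer_ne_zero hc _))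
      (qPochhammer_ne_zero (fun j => ?_) _)
    rw [mul_assoc, ← pow_add, Nat.add_right_comm]
    exact hs _

theorem phiScale_succ_succ (hs : ∀ j, s * q ^ (j + 1) ≠ 1) (a c : K) (n : ℕ) :
    phiScale q a c s (n + 2) = phiUp q a c s (n + 1) * phiScale q a c s (n + 1) := by
  have h : 1 - s * q ^ (2 * (n + 1)) ≠ 0 := sub_ne_zero.2 (hs (2 * n + 1)).symm
  have hsn : ∀ j, s * q ^ (n + 1) * q ^ j ≠ 1 := fun j => by
    simpa only [mul_assoc, ← pow_add, Nat.add_right_comm n 1 j] using hs (n + j)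
  have shift := one_sub_mul_phiScale_mul hsn a c
  rw [mul_assoc, ← pow_add, ← two_mul] at shift
  rw [phiScale_succ, phiUp, div_mul_eq_mul_div, div_mul_eq_mul_div,
    mul_assoc _ (1 - s * q ^ (n + 1)), ← shift]
  field_simp

theorem monicPhi_recurrence (hq : q ≠ 0) (hq1 : ∀ j, q ^ (j + 1) ≠ 1) (ha : ∀ j, a * q ^ j ≠ 1)
    (hc : ∀ j, c * q ^ j ≠ 1) (hs : ∀ j, s * q ^ (j + 1) ≠ 1) (n : ℕ) :
    monicPhi q a c s (n + 2) =
      (X - C (1 - phiUp q a c s (n + 1) - phiDown q a c s n)) * monicPhi q a c s (n + 1) -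
        C (phiDown q a c s n * phiScale q a c s (n + 1) / phiScale q a c s n) *
          monicPhi q a c s n := by
  have recurrence := phiPoly_recurrence hq hq1 ha hc hs n
  have ratio : C (phiDown q a c s n * phiScale q a c s (n + 1) / phiScale q a c s n) *
      C (phiScale q a c s n) = C (phiDown q a c s n) * C (phiScale q a c s (n + 1)) := by
    rw [← C_mul, ← C_mul, div_mul_cancel₀ _ (phiScale_ne_zero ha hc hs n)]
  simp only [monicPhi, phiScale_succ_succ hs, C_mul, C_sub, C_1]
  linear_combination (-C (phiScale q a c s (n + 1))) * recurrence + phiPoly q a c s n * ratio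

end Phi

end Field

theorem isZeroList_of_isRoot {p : ℝ[X]} {n : ℕ} {x : ℕ → ℝ} (hp : p.natDegree = n) (hp0 : p ≠ 0)
    (hx : StrictMonoOn x (Set.Icc 1 n)) (hr : ∀ j ∈ Set.Icc 1 n, p.IsRoot (x j)) :
    IsZeroList p n x := by
  have image_eq : (Finset.Icc 1 n).image x = p.roots.toFinset := by
    refine Finset.eq_of_subset_of_card_le (fun t ht => ?_) ?_
    · obtain ⟨j, hj, rfl⟩ := Finset.mem_image.1 ht
      exact Multiset.mem_toFinset.2 ((mem_roots hp0).2 (hr j (by simpa using hj)))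
    · rw [Finset.card_image_of_injOn (by simpa using hx.injOn), Nat.card_Icc,
        Nat.add_sub_cancel, ← hp]
      exact (Multiset.toFinset_card_le _).trans (card_roots' p)
  refine ⟨hp, hx, fun t => ?_⟩
  rw [← mem_roots hp0, ← Multiset.mem_toFinset, ← image_eq]
  simp

theorem exists_isRoot_of_mul_neg {p : ℝ[X]} {a b : ℝ} (hab : a < b)
    (h : p.eval a * p.eval b < 0) : ∃ t ∈ Set.Ioo a b, p.IsRoot t := by
  rcases mul_neg_iff.1 h with ⟨ha, hb⟩ | ⟨ha, hb⟩
  · exact intermediate_value_Ioo' hab.le p.continuousOn ⟨hb, ha⟩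
  · exact intermediate_value_Ioo hab.le p.continuousOn ⟨ha, hb⟩

theorem exists_isZeroList_of_sign_changes {p : ℝ[X]} {n : ℕ} (hp : p.natDegree = n) (hp0 : p ≠ 0)
    {g : ℕ → ℝ} (hg : ∀ j < n, g j < g (j + 1))
    (hsign : ∀ j ≤ n, 0 < (-1) ^ (n + j) * p.eval (g j)) :
    ∃ u, IsZeroList p n u ∧ ∀ j < n, g j < u (j + 1) ∧ u (j + 1) < g (j + 1) := by
  have exists_root (j : ℕ) (hj : j < n) : ∃ t ∈ Set.Ioo (g j) (g (j + 1)), p.IsRoot t := by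
    refine exists_isRoot_of_mul_neg (hg j hj) ?_
    have := mul_pos (hsign j hj.le) (hsign (j + 1) hj)
    rw [mul_mul_mul_comm, ← pow_add, Odd.neg_one_pow ⟨n + j, by ring⟩] at this
    linarith
  choose! t ht hroot using exists_root
  refine ⟨fun j => t (j - 1), isZeroList_of_isRoot hp hp0 ?_ fun j hj => ?_, ht⟩
  · refine strictMonoOn_of_lt_succ Set.ordConnected_Icc fun j _ hj hj' => ?_
    obtain ⟨j, rfl⟩ := Nat.exists_eq_add_of_le' hj.1
    exact (ht j hj.2).2.trans (ht (j + 1) hj'.2).1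
  · exact hroot _ (by have := hj.1; have := hj.2; lia)

theorem exists_gt_eval_pos {p : ℝ[X]} (hp : p.Monic) (hn : 0 < p.natDegree) (b : ℝ) :
    ∃ t, b < t ∧ 0 < p.eval t := by
  have h := tendsto_atTop_of_leadingCoeff_nonneg p (natDegree_pos_iff_degree_pos.1 hn)
    (by rw [hp.leadingCoeff]; exact zero_le_one)
  exact ((Filter.eventually_gt_atTop b).and (h.eventually_gt_atTop 0)).exists

theorem exists_lt_sign_eval {p : ℝ[X]} (hp : p.Monic) (hn : 0 < p.natDegree) (b : ℝ) :
    ∃ t, t < b ∧ 0 < (-1) ^ p.natDegree * p.eval t := by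
  have hd : (C ((-1) ^ p.natDegree) * p.comp (-X)).natDegree = p.natDegree := by
    rw [natDegree_C_mul (by simp), natDegree_comp, natDegree_neg, natDegree_X, mul_one]
  obtain ⟨t, ht, h⟩ := exists_gt_eval_pos (p := C ((-1) ^ p.natDegree) * p.comp (-X)) (by
    rw [Monic, leadingCoeff_mul, leadingCoeff_comp (by simp), hp.leadingCoeff]
    simp [← mul_pow]) (by rwa [hd]) (-b)
  exact ⟨-t, by linarith, by simpa using h⟩

/-- The lists `u 1, …, u (m + 1)` and `x 1, …, x m` interlace:
`u 1 < x 1 < u 2 < x 2 < ⋯ < x m < u (m + 1)`. -/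
def Interlaces (m : ℕ) (u x : ℕ → ℝ) : Prop :=
  ∀ j ∈ Set.Icc 1 m, u j < x j ∧ x j < u (j + 1)

theorem exists_interlaces_of_sign_eval {p : ℝ[X]} {m : ℕ} {g : ℕ → ℝ} (hp : p.Monic)
    (hd : p.natDegree = m + 1) (hg : StrictMonoOn g (Set.Icc 1 m))
    (hsign : ∀ j ∈ Set.Icc 1 m, 0 < (-1) ^ (m + 1 + j) * p.eval (g j)) :
    ∃ u, IsZeroList p (m + 1) u ∧ Interlaces m u g := by
  obtain ⟨A, hA, hsA⟩ := exists_lt_sign_eval hp (by lia) (g 1)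
  obtain ⟨B, hB, hsB⟩ := exists_gt_eval_pos hp (by lia) (max A (g m))
  obtain ⟨hAB, hgB⟩ := max_lt_iff.1 hB
  let e : ℕ → ℝ := fun j => if j = 0 then A else if j ≤ m then g j else B
  have he {j : ℕ} (hj : j ∈ Set.Icc 1 m) : e j = g j := by
    simp only [e, if_neg (Nat.one_le_iff_ne_zero.1 hj.1), if_pos hj.2]
  have heB : e (m + 1) = B := by simp [e]
  have increasing : ∀ j < m + 1, e j < e (j + 1) := by
    intro j hj
    rcases Nat.eq_zero_or_pos j with rfl | h1 <;> rcases (Nat.le_of_lt_succ hj).eq_or_lt with h | h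
    · subst h
      rwa [heB]
    · rwa [he ⟨le_rfl, h⟩]
    · rwa [h, he ⟨h ▸ h1, le_rfl⟩, heB]
    · rw [he ⟨h1, h.le⟩, he ⟨j.succ_pos, h⟩]
      exact hg ⟨h1, h.le⟩ ⟨j.succ_pos, h⟩ j.lt_succ_self
  have signs : ∀ j ≤ m + 1, 0 < (-1) ^ (m + 1 + j) * p.eval (e j) := by
    intro j hj
    rcases Nat.eq_zero_or_pos j with rfl | h1
    · rwa [hd] at hsA
    rcases hj.eq_or_lt with rfl | h
    · rwa [heB, Even.neg_one_pow ⟨m + 1, rfl⟩, one_mul]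
    · rw [he ⟨h1, Nat.le_of_lt_succ h⟩]
      exact hsign j ⟨h1, Nat.le_of_lt_succ h⟩
  obtain ⟨u, hu, hue⟩ := exists_isZeroList_of_sign_changes hd hp.ne_zero increasing signs
  refine ⟨u, hu, fun j hj => ?_⟩
  obtain ⟨i, rfl⟩ := Nat.exists_eq_add_of_le' hj.1
  rw [← he hj]
  exact ⟨(hue i (hj.2.trans m.le_succ)).2, (hue (i + 1) (Nat.succ_lt_succ hj.2)).1⟩

namespace IsZeroList

variable {p : ℝ[X]} {n : ℕ} {x : ℕ → ℝ}

theorem le_of_le (h : IsZeroList p n x) {i j : ℕ} (hi : 1 ≤ i) (hj : j ≤ n) (hij : i ≤ j) :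
    x i ≤ x j :=
  h.2.1.monotoneOn ⟨hi, hij.trans hj⟩ ⟨hi.trans hij, hj⟩ hij

theorem eval_eq_zero (h : IsZeroList p n x) {j : ℕ} (hj : j ∈ Set.Icc 1 n) : p.eval (x j) = 0 :=
  (h.2.2 _).2 ⟨j, hj, rfl⟩

theorem eq_prod (h : IsZeroList p n x) (hp : p.Monic) :
    p = ∏ i ∈ Finset.Icc 1 n, (X - C (x i)) := by
  have prod_dvd : ∏ i ∈ Finset.Icc 1 n, (X - C (x i)) ∣ p := by
    refine Finset.prod_dvd_of_coprime (fun i hi j hj hij => ?_) fun i hi => ?_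
    · refine isCoprime_X_sub_C_of_isUnit_sub (IsUnit.mk0 _ (sub_ne_zero.2 fun he => hij ?_))
      exact h.2.1.injOn (by simpa using hi) (by simpa using hj) he
    · exact dvd_iff_isRoot.2 ((h.2.2 _).2 ⟨i, by simpa using hi, rfl⟩)
  refine eq_of_monic_of_dvd_of_natDegree_le (monic_prod_of_monic _ _ fun i _ => monic_X_sub_C _)
    hp prod_dvd ?_
  rw [natDegree_prod_of_monic _ _ fun i _ => monic_X_sub_C _, h.1]
  simp

theorem sign_eval (h : IsZeroList p n x) (hp : p.Monic) {k : ℕ} (hk : k ≤ n) {t : ℝ}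
    (hl : 1 ≤ k → x k < t) (hr : k < n → t < x (k + 1)) : 0 < (-1) ^ (n + k) * p.eval t := by
  have below (i : ℕ) (hi : i ∈ Finset.Ioc 0 k) : 0 < t - x i := by
    obtain ⟨h0, hik⟩ := Finset.mem_Ioc.1 hi
    exact sub_pos.2 ((h.le_of_le h0 hk hik).trans_lt (hl (h0.trans_le hik)))
  have above (i : ℕ) (hi : i ∈ Finset.Ioc k n) : 0 < -(t - x i) := by
    obtain ⟨hki, hin⟩ := Finset.mem_Ioc.1 hi
    exact neg_pos.2 (sub_neg.2 ((hr (hki.trans_le hin)).trans_le (h.le_of_le k.succ_pos hin hki)))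
  have sign : (-1 : ℝ) ^ (n + k) = (-1) ^ (n - k) :=
    neg_one_pow_congr (by simp only [Nat.even_add, Nat.even_sub hk])
  rw [h.eq_prod hp, eval_prod, sign, ← Nat.card_Ioc]
  simp only [eval_sub, eval_X, eval_C]
  rw [show Finset.Icc 1 n = Finset.Ioc 0 n from rfl,
    ← Finset.prod_Ioc_consecutive (fun i => t - x i) (Nat.zero_le k) hk, mul_left_comm,
    ← Finset.prod_neg]
  exact mul_pos (Finset.prod_pos below) (Finset.prod_pos above)

theorem lt_of_sign_eval (h : IsZeroList p n x) (hp : p.Monic) {j : ℕ} (hj : j ∈ Set.Icc 1 n)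
    {t : ℝ} (hl : 2 ≤ j → x (j - 1) < t) (ht : 0 < (-1) ^ (n + j) * p.eval t) : x j < t := by
  obtain ⟨k, rfl⟩ := Nat.exists_eq_add_of_le' hj.1
  by_contra! hle
  rcases hle.eq_or_lt with rfl | hlt
  · simp [h.eval_eq_zero hj] at ht
  · have := h.sign_eval hp (Nat.le_of_succ_le hj.2) (fun hk => hl (Nat.succ_le_succ hk))
      fun _ => hlt
    rw [← add_assoc, pow_succ] at ht
    linarith

theorem gt_of_sign_eval (h : IsZeroList p n x) (hp : p.Monic) {j : ℕ} (hj : j ∈ Set.Icc 1 n)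
    {t : ℝ} (hr : j < n → t < x (j + 1)) (ht : 0 < (-1) ^ (n + j + 1) * p.eval t) : t < x j := by
  by_contra! hle
  rcases hle.eq_or_lt with rfl | hlt
  · simp [h.eval_eq_zero hj] at ht
  · have := h.sign_eval hp hj.2 (fun _ => hlt) hr
    rw [pow_succ] at ht
    linarith

end IsZeroList

section Interlacing

variable {p p' : ℝ[X]} {m : ℕ} {x x' : ℕ → ℝ}

theorem Interlaces.sign_eval_left (hi : Interlaces m x x') (hx' : IsZeroList p' m x')
    (hp' : p'.Monic) {j : ℕ} (hj : j ∈ Set.Icc 1 (m + 1)) :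
    0 < (-1) ^ (m + 1 + j) * p'.eval (x j) := by
  obtain ⟨k, rfl⟩ := Nat.exists_eq_add_of_le' hj.1
  have hk := Nat.le_of_succ_le_succ hj.2
  have := hx'.sign_eval hp' hk (fun h => (hi k ⟨h, hk⟩).2) fun h => (hi (k + 1) ⟨k.succ_pos, h⟩).1
  rwa [Nat.add_add_add_comm, pow_add, Even.neg_one_pow ⟨1, rfl⟩, mul_one]

theorem Interlaces.sign_eval_right (hi : Interlaces m x x') (hx : IsZeroList p (m + 1) x)
    (hp : p.Monic) {j : ℕ} (hj : j ∈ Set.Icc 1 m) : 0 < (-1) ^ (m + 1 + j) * p.eval (x' j) :=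
  hx.sign_eval hp (hj.2.trans m.le_succ) (fun _ => (hi j hj).1) fun _ => (hi j hj).2

theorem exists_interlaces_succ {p'' : ℝ[X]} {b l : ℝ} (hp' : p'.Monic) (hp'' : p''.Monic)
    (hd : p''.natDegree = m + 2) (hx : IsZeroList p (m + 1) x) (hx' : IsZeroList p' m x')
    (hi : Interlaces m x x') (hl : 0 < l) (recurrence : p'' = (X - C b) * p - C l * p') :
    ∃ u, IsZeroList p'' (m + 2) u ∧ Interlaces (m + 1) u x := by
  refine exists_interlaces_of_sign_eval hp'' hd hx.2.1 fun j hj => ?_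
  have := mul_pos hl (hi.sign_eval_left hx' hp' hj)
  rw [recurrence]
  simp only [eval_sub, eval_mul, eval_C, hx.eval_eq_zero hj]
  linear_combination this

theorem monic_add_C_mul (hp : p.Monic) (hd : p.natDegree = m + 1) (hd' : p'.natDegree = m)
    (a : ℝ) : (p + C a * p').Monic ∧ (p + C a * p').natDegree = m + 1 := by
  have hlt : (C a * p').natDegree < p.natDegree := by
    rw [hd]
    exact (natDegree_C_mul_le a p').trans_lt (by lia)
  exact ⟨hp.add_of_left (degree_lt_degree hlt),
    by rw [natDegree_add_eq_left_of_natDegree_lt hlt, hd]⟩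

theorem exists_isZeroList_add_C_mul (hp : p.Monic) (hp' : p'.Monic) (hx : IsZeroList p (m + 1) x)
    (hx' : IsZeroList p' m x') (hi : Interlaces m x x') (a : ℝ) :
    ∃ y, IsZeroList (p + C a * p') (m + 1) y ∧ Interlaces m y x' ∧
      ∀ j ∈ Set.Icc 1 (m + 1), (a < 0 → x j < y j) ∧ (0 < a → y j < x j) := by
  obtain ⟨hQ, hd⟩ := monic_add_C_mul hp hx.1 hx'.1 a
  obtain ⟨y, hy, hyx'⟩ := exists_interlaces_of_sign_eval hQ hd hx'.2.1 fun j hj => by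
    simpa [hx'.eval_eq_zero hj] using hi.sign_eval_right hx hp hj
  refine ⟨y, hy, hyx', fun j hj => ⟨fun ha => ?_, fun ha => ?_⟩⟩
  all_goals
    have sign := hi.sign_eval_left hx' hp' hj
  · refine hy.gt_of_sign_eval hQ hj (fun h => ?_) ?_
    · have hj' : j ∈ Set.Icc 1 m := ⟨hj.1, Nat.le_of_lt_succ h⟩
      exact (hi j hj').1.trans (hyx' j hj').2
    · have := mul_pos (neg_pos.2 ha) sign
      simp only [eval_add, eval_mul, eval_C, hx.eval_eq_zero hj, pow_succ _ (m + 1 + j)]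
      linear_combination this
  · refine hy.lt_of_sign_eval hQ hj (fun h => ?_) ?_
    · obtain ⟨k, rfl⟩ := Nat.exists_eq_add_of_le' h
      have hk : k + 1 ∈ Set.Icc 1 m := ⟨k.succ_pos, Nat.le_of_succ_le_succ hj.2⟩
      exact (hyx' _ hk).1.trans (hi _ hk).2
    · have := mul_pos ha sign
      simp only [eval_add, eval_mul, eval_C, hx.eval_eq_zero hj]
      linear_combination this

end Interlacing

theorem mul_pow_lt_of_lt {q x b : ℝ} (hq0 : 0 < q) (hq1 : q < 1) (hb : 0 ≤ b) (hx : x < b)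
    (j : ℕ) : x * q ^ j < b :=
  (mul_lt_mul_of_pos_right hx (pow_pos hq0 j)).trans_le
    (mul_le_of_le_one_right hb (pow_le_one₀ hq0.le hq1.le))

theorem mul_pow_lt_one {q x : ℝ} (hq0 : 0 < q) (hq1 : q < 1) (hx : x < 1) (j : ℕ) :
    x * q ^ j < 1 :=
  mul_pow_lt_of_lt hq0 hq1 zero_le_one hx j

theorem mul_pow_ne_one {q x : ℝ} (hq0 : 0 < q) (hq1 : q < 1) (hx : 1 < x) (hxq : x * q < 1) :
    ∀ j, x * q ^ j ≠ 1
  | 0 => by simpa using hx.ne'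
  | j + 1 => by simpa only [pow_succ', mul_assoc] using (mul_pow_lt_one hq0 hq1 hxq j).ne

section Contiguous

variable {q a c s : ℝ} {n : ℕ}

theorem contiguous_denom_pos (hq0 : 0 < q) (hq1 : q < 1) (hs : s * q ^ (n + 1) < 1) :
    0 < (1 - s * q ^ (2 * n + 1)) * (1 - s * q ^ (2 * n + 2)) := by
  rw [show s * q ^ (2 * n + 1) = s * q ^ (n + 1) * q ^ n by ring,
    show s * q ^ (2 * n + 2) = s * q ^ (n + 1) * q ^ (n + 1) by ring]
  exact mul_pos (sub_pos.2 (mul_pow_lt_one hq0 hq1 hs n))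
    (sub_pos.2 (mul_pow_lt_one hq0 hq1 hs (n + 1)))

theorem exists_pos_monicPhi_eq_add_mul (hq0 : 0 < q) (hq1 : q < 1) (ha : a < 1) (hc : c < 1)
    (hs0 : 0 < s) (hs : s * q ^ (n + 1) < 1) :
    ∃ k, 0 < k ∧ monicPhi q a c s (n + 1) =
      monicPhi q a c (s * q) (n + 1) + C k * monicPhi q a c (s * q) n := by
  refine ⟨_, div_pos ?_ (contiguous_denom_pos hq0 hq1 hs),
    monicPhi_eq_add_mul hq0.ne' (fun j => (mul_pow_lt_one hq0 hq1 hs j).ne) a c⟩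
  have hqn := sub_pos.2 (pow_lt_one₀ hq0.le hq1 n.succ_ne_zero)
  have han := sub_pos.2 (mul_pow_lt_one hq0 hq1 ha n)
  have hcn := sub_pos.2 (mul_pow_lt_one hq0 hq1 hc n)
  positivity

theorem exists_pos_monicPhi_eq_add_mul_right (hq0 : 0 < q) (hq1 : q < 1) (ha : a < 1)
    (hc : c < 1) (hs : s * q ^ (n + 1) < 1) (hcs : c < s * q ^ (n + 1)) :
    ∃ k, 0 < k ∧ monicPhi q a c s (n + 1) =
      monicPhi q a (c * q) (s * q) (n + 1) + C k * monicPhi q a (c * q) (s * q) n := by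
  have contiguous := monicPhi_eq_add_mul_left hq0.ne' (fun j => (mul_pow_lt_one hq0 hq1 hc j).ne)
    (fun j => (mul_pow_lt_one hq0 hq1 hs j).ne) a
  simp only [monicPhi_swap q a] at contiguous
  refine ⟨_, div_pos (neg_pos.2 ?_) (contiguous_denom_pos hq0 hq1 hs), contiguous⟩
  have hqn := sub_pos.2 (pow_lt_one₀ hq0.le hq1 n.succ_ne_zero)
  have han := sub_pos.2 (mul_pow_lt_one hq0 hq1 ha n)
  exact mul_neg_of_neg_of_pos (mul_neg_of_pos_of_neg hqn (sub_neg.2 hcs)) han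

theorem exists_neg_monicPhi_eq_add_mul_left (hq0 : 0 < q) (hq1 : q < 1) (ha : 1 < a)
    (haq : a * q < 1) (hc : c < 1) (hs : s * q ^ (n + 1) < 1) :
    ∃ k < 0, monicPhi q a c s (n + 1) =
      monicPhi q (a * q) c (s * q) (n + 1) + C k * monicPhi q (a * q) c (s * q) n := by
  refine ⟨_, div_neg_of_neg_of_pos (neg_neg_of_pos ?_) (contiguous_denom_pos hq0 hq1 hs),
    monicPhi_eq_add_mul_left hq0.ne' (mul_pow_ne_one hq0 hq1 ha haq)
      (fun j => (mul_pow_lt_one hq0 hq1 hs j).ne) c⟩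
  have hqn := sub_pos.2 (pow_lt_one₀ hq0.le hq1 n.succ_ne_zero)
  have hcn := sub_pos.2 (mul_pow_lt_one hq0 hq1 hc n)
  exact mul_pos (mul_pos hqn (sub_pos.2 (hs.trans ha))) hcn

theorem sign_eval_monicPhi_right (hq0 : 0 < q) (hq1 : q < 1) (ha : ∀ j, a * q ^ j ≠ 1)
    (hc : c < 1) (hs : s * q ^ n < 1) {k : ℕ}
    (hsign : 0 < (-1) ^ k * ∏ j ∈ Finset.range n, (s * q ^ n - a * q ^ j)) :
    0 < (-1) ^ k * (monicPhi q a c s n).eval c := by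
  have hc' := mul_pow_lt_one hq0 hq1 hc
  rw [eval_monicPhi_right hq0.ne' (fun j => (pow_lt_one₀ hq0.le hq1 j.succ_ne_zero).ne) ha
    (fun j => (hc' j).ne), mul_div_assoc', mul_left_comm]
  exact div_pos (mul_pos (qPochhammer_pos hc' n) hsign)
    (qPochhammer_pos (mul_pow_lt_one hq0 hq1 hs) n)

/-- Compared with the orthogonal range `s * q < a`, only the factor `s * q ^ (n + 1) - a * q ^ n` of
the value at `c` has changed its sign. -/
theorem sign_eval_monicPhi_right_of_lt (hq0 : 0 < q) (hq1 : q < 1) (ha : ∀ j, a * q ^ j ≠ 1)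
    (hc : c < 1) (hs : s * q ^ (n + 1) < 1) (ha0 : 0 ≤ a) (has : a < s * q) (hsa : s * q ^ 2 < a) :
    0 < (-1) ^ n * (monicPhi q a c s (n + 1)).eval c := by
  refine sign_eval_monicPhi_right hq0 hq1 ha hc hs ?_
  have other_factors (j : ℕ) (hj : j ∈ Finset.range n) : 0 < -(s * q ^ (n + 1) - a * q ^ j) := by
    obtain ⟨k, rfl⟩ := Nat.exists_eq_add_of_lt (Finset.mem_range.1 hj)
    rw [neg_sub, sub_pos, show s * q ^ (j + k + 1 + 1) = s * q ^ 2 * q ^ k * q ^ j by ring]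
    exact mul_lt_mul_of_pos_right (mul_pow_lt_of_lt hq0 hq1 ha0 hsa k) (pow_pos hq0 j)
  have last_factor : 0 < s * q ^ (n + 1) - a * q ^ n := by
    rw [pow_succ', ← mul_assoc, ← sub_mul]
    exact mul_pos (sub_pos.2 has) (pow_pos hq0 n)
  have hprod := Finset.prod_pos other_factors
  rw [Finset.prod_neg, Finset.card_range] at hprod
  rw [Finset.prod_range_succ, ← mul_assoc]
  exact mul_pos hprod last_factor

end Contiguous

/-- The range of the parameters `a = αq`, `c = γq`, `s = αβq` in which the big `q`-Jacobi
polynomials are orthogonal with respect to a positive measure on `[c, a]`. -/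
structure IsOrthogonalParam (q a c s : ℝ) : Prop where
  q_pos : 0 < q
  q_lt_one : q < 1
  right_nonpos : c ≤ 0
  left_nonneg : 0 ≤ a
  left_lt_one : a < 1
  right_lt : c < s * q
  lt_left : s * q < a

namespace IsOrthogonalParam

variable {q a c s : ℝ}

theorem right_mul_pow_lt (h : IsOrthogonalParam q a c s) {n j : ℕ} (hj : j ≤ n) :
    c * q ^ j < s * q ^ (n + 1) := by
  obtain ⟨k, rfl⟩ := Nat.exists_eq_add_of_le hj
  rw [show s * q ^ (j + k + 1) = s * q * q ^ k * q ^ j by ring]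
  refine mul_lt_mul_of_pos_right ?_ (pow_pos h.q_pos j)
  have := mul_pow_lt_of_lt h.q_pos h.q_lt_one (neg_nonneg.2 h.right_nonpos)
    (neg_lt_neg h.right_lt) k
  rwa [neg_mul, neg_lt_neg_iff] at this

theorem lt_left_mul_pow (h : IsOrthogonalParam q a c s) {n j : ℕ} (hj : j ≤ n) :
    s * q ^ (n + 1) < a * q ^ j := by
  obtain ⟨k, rfl⟩ := Nat.exists_eq_add_of_le hj
  rw [show s * q ^ (j + k + 1) = s * q * q ^ k * q ^ j by ring]
  exact mul_lt_mul_of_pos_right (mul_pow_lt_of_lt h.q_pos h.q_lt_one h.left_nonneg h.lt_left k)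
    (pow_pos h.q_pos j)

theorem right_lt_mul_pow (h : IsOrthogonalParam q a c s) (n : ℕ) : c < s * q ^ (n + 1) := by
  simpa using h.right_mul_pow_lt n.zero_le

theorem mul_pow_lt_left (h : IsOrthogonalParam q a c s) (n : ℕ) : s * q ^ (n + 1) < a := by
  simpa using h.lt_left_mul_pow n.zero_le

theorem right_lt_one (h : IsOrthogonalParam q a c s) : c < 1 :=
  h.right_nonpos.trans_lt one_pos

theorem mul_pow_lt_one (h : IsOrthogonalParam q a c s) (k : ℕ) : s * q ^ (k + 1) < 1 :=
  (h.mul_pow_lt_left k).trans h.left_lt_one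

theorem left_ne_one (h : IsOrthogonalParam q a c s) (j : ℕ) : a * q ^ j ≠ 1 :=
  (_root_.mul_pow_lt_one h.q_pos h.q_lt_one h.left_lt_one j).ne

theorem right_ne_one (h : IsOrthogonalParam q a c s) (j : ℕ) : c * q ^ j ≠ 1 :=
  (_root_.mul_pow_lt_one h.q_pos h.q_lt_one h.right_lt_one j).ne

theorem q_ne_one (h : IsOrthogonalParam q a c s) (j : ℕ) : q ^ (j + 1) ≠ 1 :=
  (pow_lt_one₀ h.q_pos.le h.q_lt_one j.succ_ne_zero).ne

theorem mul_pow_succ_mul_pow_lt_one (h : IsOrthogonalParam q a c s) (n j : ℕ) :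
    s * q ^ (n + 1) * q ^ j < 1 :=
  _root_.mul_pow_lt_one h.q_pos h.q_lt_one (h.mul_pow_lt_one n) j

theorem monic (h : IsOrthogonalParam q a c s) : ∀ n, (monicPhi q a c s n).Monic
  | 0 => monicPhi_zero q a c s ▸ monic_one
  | n + 1 => monic_monicPhi h.q_pos.ne' h.q_ne_one h.left_ne_one h.right_ne_one
      fun j => (h.mul_pow_succ_mul_pow_lt_one n j).ne

theorem natDegree_eq (h : IsOrthogonalParam q a c s) : ∀ n, (monicPhi q a c s n).natDegree = n
  | 0 => by rw [monicPhi_zero, natDegree_one]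
  | n + 1 => natDegree_monicPhi h.q_pos.ne' h.q_ne_one h.left_ne_one h.right_ne_one
      fun j => (h.mul_pow_succ_mul_pow_lt_one n j).ne

theorem phiScale_pos (h : IsOrthogonalParam q a c s) : ∀ n, 0 < phiScale q a c s n
  | 0 => by simp [phiScale]
  | n + 1 => div_pos
      (mul_pos (qPochhammer_pos (_root_.mul_pow_lt_one h.q_pos h.q_lt_one h.left_lt_one) _)
        (qPochhammer_pos (_root_.mul_pow_lt_one h.q_pos h.q_lt_one h.right_lt_one) _))
      (qPochhammer_pos (h.mul_pow_succ_mul_pow_lt_one n) _)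

theorem phiDown_pos (h : IsOrthogonalParam q a c s) (n : ℕ) : 0 < phiDown q a c s n := by
  refine div_pos (neg_pos.2 ?_) (contiguous_denom_pos h.q_pos h.q_lt_one (h.mul_pow_lt_one n))
  refine mul_neg_of_pos_of_neg (mul_pos (mul_pos (pow_pos h.q_pos n) ?_) ?_) ?_
  · exact sub_pos.2 (pow_lt_one₀ h.q_pos.le h.q_lt_one n.succ_ne_zero)
  · exact sub_pos.2 (h.mul_pow_lt_left n)
  · exact sub_neg.2 (h.right_lt_mul_pow n)

theorem exists_pos_recurrence (h : IsOrthogonalParam q a c s) (n : ℕ) :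
    ∃ b l : ℝ, 0 < l ∧ monicPhi q a c s (n + 2) =
      (X - C b) * monicPhi q a c s (n + 1) - C l * monicPhi q a c s n :=
  ⟨_, _, div_pos (mul_pos (h.phiDown_pos n) (h.phiScale_pos _)) (h.phiScale_pos n),
    monicPhi_recurrence h.q_pos.ne' h.q_ne_one h.left_ne_one h.right_ne_one
      (fun j => (h.mul_pow_lt_one j).ne) n⟩

theorem sign_eval_right (h : IsOrthogonalParam q a c s) (n : ℕ) :
    0 < (-1) ^ (n + 1) * (monicPhi q a c s (n + 1)).eval c := by
  refine sign_eval_monicPhi_right h.q_pos h.q_lt_one h.left_ne_one h.right_lt_one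
    (h.mul_pow_lt_one n) ?_
  have hprod : 0 < ∏ j ∈ Finset.range (n + 1), -(s * q ^ (n + 1) - a * q ^ j) :=
    Finset.prod_pos fun j hj =>
      neg_pos.2 (sub_neg.2 (h.lt_left_mul_pow (Finset.mem_range_succ_iff.1 hj)))
  rwa [Finset.prod_neg, Finset.card_range] at hprod

theorem eval_left_pos (h : IsOrthogonalParam q a c s) (n : ℕ) :
    0 < (monicPhi q a c s (n + 1)).eval a := by
  rw [eval_monicPhi_left h.q_pos.ne' h.q_ne_one h.left_ne_one h.right_ne_one]
  have hprod : 0 < ∏ j ∈ Finset.range (n + 1), (s * q ^ (n + 1) - c * q ^ j) :=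
    Finset.prod_pos fun j hj => sub_pos.2 (h.right_mul_pow_lt (Finset.mem_range_succ_iff.1 hj))
  exact div_pos (mul_pos (qPochhammer_pos
    (_root_.mul_pow_lt_one h.q_pos h.q_lt_one h.left_lt_one) _) hprod)
    (qPochhammer_pos (h.mul_pow_succ_mul_pow_lt_one n) _)

theorem mem_Ioo (h : IsOrthogonalParam q a c s) {m : ℕ} {x x' : ℕ → ℝ}
    (hx : IsZeroList (monicPhi q a c s (m + 1)) (m + 1) x) (hi : Interlaces m x x')
    (hx' : ∀ j ∈ Set.Icc 1 m, x' j ∈ Set.Ioo c a) :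
    ∀ j ∈ Set.Icc 1 (m + 1), x j ∈ Set.Ioo c a := by
  have first : c < x 1 := by
    refine hx.gt_of_sign_eval (h.monic _) ⟨le_rfl, m.succ_pos⟩ (fun hm => ?_) ?_
    · have hm' : 1 ∈ Set.Icc 1 m := ⟨le_rfl, Nat.le_of_lt_succ hm⟩
      exact (hx' 1 hm').1.trans (hi 1 hm').2
    · simpa [pow_succ] using h.sign_eval_right m
  have last : x (m + 1) < a := by
    refine hx.lt_of_sign_eval (h.monic _) ⟨m.succ_pos, le_rfl⟩ (fun hm => ?_) ?_
    · have hm' : m ∈ Set.Icc 1 m := ⟨Nat.le_of_succ_le_succ hm, le_rfl⟩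
      exact (hi m hm').1.trans (hx' m hm').2
    · rw [Even.neg_one_pow ⟨m + 1, rfl⟩, one_mul]
      exact h.eval_left_pos m
  exact fun j hj => ⟨first.trans_le (hx.le_of_le le_rfl hj.2 hj.1),
    (hx.le_of_le hj.1 le_rfl hj.2).trans_lt last⟩

theorem exists_interlaces (h : IsOrthogonalParam q a c s) (m : ℕ) : ∃ x x' : ℕ → ℝ,
    IsZeroList (monicPhi q a c s (m + 1)) (m + 1) x ∧ IsZeroList (monicPhi q a c s m) m x' ∧
      Interlaces m x x' ∧ ∀ j ∈ Set.Icc 1 (m + 1), x j ∈ Set.Ioo c a := by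
  induction m with
  | zero =>
    obtain ⟨x, hx, hi⟩ := exists_interlaces_of_sign_eval (g := 0) (h.monic 1) (h.natDegree_eq 1)
      (by simp [StrictMonoOn]) (by simp)
    refine ⟨x, 0, hx, ⟨h.natDegree_eq 0, by simp [StrictMonoOn], by simp [monicPhi_zero]⟩, hi,
      h.mem_Ioo hx hi (by simp)⟩
  | succ m ih =>
    obtain ⟨x, x', hx, hx', hi, hmem⟩ := ih
    obtain ⟨b, l, hl, recurrence⟩ := h.exists_pos_recurrence m
    obtain ⟨u, hu, hi'⟩ := exists_interlaces_succ (h.monic m) (h.monic _) (h.natDegree_eq _) hx hx'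
      hi hl recurrence
    exact ⟨u, x, hu, hx, hi', h.mem_Ioo hu hi' hmem⟩

theorem mul_pow_add_two_lt_one (h : IsOrthogonalParam q a c (s * q)) (n : ℕ) :
    s * q ^ (n + 2) < 1 := by
  simpa only [pow_succ', mul_assoc] using h.mul_pow_lt_one n

theorem exists_isZeroList_left_shift (h : IsOrthogonalParam q (a * q) c (s * q)) (ha : 1 < a)
    {m : ℕ} {x x' : ℕ → ℝ} (hx : IsZeroList (monicPhi q (a * q) c (s * q) (m + 2)) (m + 2) x)
    (hx' : IsZeroList (monicPhi q (a * q) c (s * q) (m + 1)) (m + 1) x')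
    (hi : Interlaces (m + 1) x x') :
    ∃ y, IsZeroList (monicPhi q a c s (m + 2)) (m + 2) y ∧
      (∀ j ∈ Set.Icc 1 (m + 2), x j < y j) ∧ Interlaces (m + 1) y x' := by
  obtain ⟨k, hk, contiguous⟩ := exists_neg_monicPhi_eq_add_mul_left h.q_pos h.q_lt_one ha
    h.left_lt_one h.right_lt_one (h.mul_pow_add_two_lt_one m)
  obtain ⟨y, hy, hyx', hxy⟩ := exists_isZeroList_add_C_mul (h.monic _) (h.monic _) hx hx' hi k
  exact ⟨y, contiguous ▸ hy, fun j hj => (hxy j hj).1 hk, hyx'⟩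

theorem exists_isZeroList_right_shift (h : IsOrthogonalParam q a (c * q) (s * q)) {m : ℕ}
    {x x' : ℕ → ℝ} (hx : IsZeroList (monicPhi q a (c * q) (s * q) (m + 2)) (m + 2) x)
    (hx' : IsZeroList (monicPhi q a (c * q) (s * q) (m + 1)) (m + 1) x')
    (hi : Interlaces (m + 1) x x') :
    ∃ w, IsZeroList (monicPhi q a c s (m + 2)) (m + 2) w ∧
      (∀ j ∈ Set.Icc 1 (m + 2), w j < x j) ∧ Interlaces (m + 1) w x' := by
  have hc : c ≤ 0 := nonpos_of_mul_nonpos_left h.right_nonpos h.q_pos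
  have hcs : c < s * q ^ (m + 2) := by
    refine lt_of_mul_lt_mul_right ?_ h.q_pos.le
    simpa only [pow_succ', mul_assoc, mul_comm, mul_left_comm] using h.right_lt_mul_pow (m + 1)
  obtain ⟨k, hk, contiguous⟩ := exists_pos_monicPhi_eq_add_mul_right h.q_pos h.q_lt_one
    h.left_lt_one (hc.trans_lt one_pos) (h.mul_pow_add_two_lt_one m) hcs
  obtain ⟨w, hw, hwx', hwx⟩ := exists_isZeroList_add_C_mul (h.monic _) (h.monic _) hx hx' hi k
  exact ⟨w, contiguous ▸ hw, fun j hj => (hwx j hj).2 hk, hwx'⟩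

theorem exists_isZeroList_prod_shift (h : IsOrthogonalParam q a c (s * q)) (has : a < s * q)
    {m : ℕ} {x x' : ℕ → ℝ} (hx : IsZeroList (monicPhi q a c (s * q) (m + 2)) (m + 2) x)
    (hx' : IsZeroList (monicPhi q a c (s * q) (m + 1)) (m + 1) x')
    (hi : Interlaces (m + 1) x x') :
    ∃ z, IsZeroList (monicPhi q a c s (m + 2)) (m + 2) z ∧
      (∀ j ∈ Set.Icc 1 (m + 2), z j < x j) ∧ Interlaces (m + 1) z x' ∧ z 1 < c := by
  have hs : s * q ^ (m + 2) < 1 := h.mul_pow_add_two_lt_one m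
  obtain ⟨k, hk, contiguous⟩ := exists_pos_monicPhi_eq_add_mul h.q_pos h.q_lt_one h.left_lt_one
    h.right_lt_one (pos_of_mul_pos_left (h.left_nonneg.trans_lt has) h.q_pos.le) hs
  obtain ⟨z, hz, hzx', hzx⟩ := exists_isZeroList_add_C_mul (h.monic _) (h.monic _) hx hx' hi k
  have hmonic := (monic_add_C_mul (h.monic _) hx.1 hx'.1 k).1
  rw [← contiguous] at hz hmonic
  refine ⟨z, hz, fun j hj => (hzx j hj).2 hk, hzx',
    hz.lt_of_sign_eval hmonic (by simp) (by simp) ?_⟩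
  have := sign_eval_monicPhi_right_of_lt h.q_pos h.q_lt_one h.left_ne_one h.right_lt_one hs
    h.left_nonneg has (by simpa only [sq, mul_assoc] using h.lt_left)
  simpa [pow_succ] using this

theorem exists_pos_eval_both_shift (h : IsOrthogonalParam q (a * q) c (s * q * q)) (ha : 1 < a)
    (hs : 0 < s) (m : ℕ) : ∃ r, 0 < r ∧
      ∀ t, (monicPhi q (a * q) c (s * q * q) (m + 2)).IsRoot t →
        (monicPhi q a c s (m + 3)).eval t =
          r * (monicPhi q (a * q) c (s * q * q) (m + 3)).eval t := by
  have hsq : 0 < s * q := mul_pos hs h.q_pos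
  obtain ⟨k₁, hk₁, left_shift⟩ := exists_neg_monicPhi_eq_add_mul_left h.q_pos h.q_lt_one ha
    h.left_lt_one h.right_lt_one (s := s) (n := m + 2)
    (by simpa only [pow_succ', mul_assoc] using h.mul_pow_lt_one m)
  obtain ⟨k₂, -, prod_shift⟩ := exists_pos_monicPhi_eq_add_mul h.q_pos h.q_lt_one h.left_lt_one
    h.right_lt_one hsq (h.mul_pow_add_two_lt_one (m + 1))
  obtain ⟨k₃, hk₃, prod_shift'⟩ := exists_pos_monicPhi_eq_add_mul h.q_pos h.q_lt_one h.left_lt_one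
    h.right_lt_one hsq (h.mul_pow_add_two_lt_one m)
  obtain ⟨b, l, hl, recurrence⟩ := h.exists_pos_recurrence (m + 1)
  refine ⟨1 + -k₁ * k₃ / l, by have := neg_pos.2 hk₁; positivity, fun t ht => ?_⟩
  rw [left_shift, prod_shift, prod_shift', recurrence]
  simp only [eval_add, eval_sub, eval_mul, eval_C, ht.eq_zero]
  field_simp
  ring

theorem exists_isZeroList_both_shift (h : IsOrthogonalParam q (a * q) c (s * q * q)) (ha : 1 < a)
    (has : a < s * q) (m : ℕ) :
    ∃ v, IsZeroList (monicPhi q a c s (m + 3)) (m + 3) v ∧ v 1 < c := by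
  have ha0 : 0 < a := one_pos.trans ha
  have ha' := mul_pow_ne_one h.q_pos h.q_lt_one ha h.left_lt_one
  have hs : s * q ^ (m + 3) < 1 := by
    simpa only [pow_succ', mul_assoc] using h.mul_pow_lt_one m
  have hs' := fun j => (_root_.mul_pow_lt_one h.q_pos h.q_lt_one hs j).ne
  have hmonic := monic_monicPhi h.q_pos.ne' h.q_ne_one ha' h.right_ne_one hs'
  have hdegree := natDegree_monicPhi h.q_pos.ne' h.q_ne_one ha' h.right_ne_one hs'
  obtain ⟨r, hr, eval_eq⟩ := h.exists_pos_eval_both_shift ha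
    (pos_of_mul_pos_left (ha0.trans has) h.q_pos.le) m
  obtain ⟨x, x', hx, hx', hi, -⟩ := h.exists_interlaces (m + 2)
  obtain ⟨v, hv, -⟩ := exists_interlaces_of_sign_eval hmonic hdegree hx'.2.1 fun j hj => by
    rw [eval_eq _ ((hx'.2.2 _).2 ⟨j, hj, rfl⟩), mul_left_comm]
    exact mul_pos hr (hi.sign_eval_right hx (h.monic _) hj)
  refine ⟨v, hv, hv.lt_of_sign_eval hmonic (by simp) (by simp) ?_⟩
  have hsa : s * q ^ 2 < a := by
    rw [sq, ← mul_assoc]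
    exact lt_of_mul_lt_mul_right h.lt_left h.q_pos.le
  have := sign_eval_monicPhi_right_of_lt h.q_pos h.q_lt_one ha' h.right_lt_one hs ha0.le has hsa
  simpa [pow_succ] using this

end IsOrthogonalParam

theorem bigQJacobi_eq_monicPhi (n : ℕ) (α β γ q : ℝ) :
    bigQJacobi n α β γ q = monicPhi q (α * q) (γ * q) (α * β * q) n := by
  simp only [bigQJacobi, monicPhi, phiPoly, phiScale, phiCoeff, pow_succ', mul_assoc]

theorem isOrthogonalParam_bigQJacobi {q α β γ : ℝ} (hq0 : 0 < q) (hq1 : q < 1) (hα0 : 0 < α * q)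
    (hα1 : α * q < 1) (hβ : β * q < 1) (hγ0 : γ ≤ 0) (hγ : γ < α * β * q) :
    IsOrthogonalParam q (α * q) (γ * q) (α * β * q) where
  q_pos := hq0
  q_lt_one := hq1
  right_nonpos := mul_nonpos_of_nonpos_of_nonneg hγ0 hq0.le
  left_nonneg := hα0.le
  left_lt_one := hα1
  right_lt := mul_lt_mul_of_pos_right hγ hq0
  lt_left := by
    rw [mul_assoc α β q, mul_right_comm]
    exact mul_lt_of_lt_one_right hα0 hβ

end

theorem theorem2p4_general (n : ℕ) (hn : 2 ≤ n) (q α β γ : ℝ)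
    (hq0 : 0 < q) (hq1 : q < 1)
    (hα0 : 0 < α * q) (hα1 : α * q < 1) (hβ1 : β * q < 1) (hγ0 : γ ≤ 0) (hγ : γ < α * β * q) :
    ∃ x x' : ℕ → ℝ,
      IsZeroList (bigQJacobi n α β γ q) n x ∧
      IsZeroList (bigQJacobi (n - 1) α β γ q) (n - 1) x' ∧
      (1 < α → ∃ y : ℕ → ℝ, IsZeroList (bigQJacobi n (α / q) β γ q) n y ∧
        γ * q < x 1 ∧
        (∀ j ∈ Set.Icc 1 n, x j < y j) ∧
        (∀ j ∈ Set.Icc 1 (n - 1), y j < x' j ∧ x' j < x (j + 1))) ∧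
      (1 < β → ∃ z : ℕ → ℝ, IsZeroList (bigQJacobi n α (β / q) γ q) n z ∧
        z 1 < γ * q ∧ γ * q < x 1 ∧
        (∀ j ∈ Set.Icc 1 n, z j < x j) ∧
        (∀ j ∈ Set.Icc 1 (n - 1), x j < x' j ∧ x' j < z (j + 1)) ∧
        x n < α * q) ∧
      (∃ w : ℕ → ℝ, IsZeroList (bigQJacobi n α (β / q) (γ / q) q) n w ∧
        (∀ j ∈ Set.Icc 1 n, w j < x j) ∧
        (∀ j ∈ Set.Icc 1 (n - 1), x j < x' j ∧ x' j < w (j + 1)) ∧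
        x n < α * q) ∧
      (3 ≤ n → 1 < α → 1 < β →
        ∃ v : ℕ → ℝ, IsZeroList (bigQJacobi n (α / q) (β / q) γ q) n v ∧ v 1 < γ * q) := by
  have hα : 0 < α := pos_of_mul_pos_left hα0 hq0.le
  have h := isOrthogonalParam_bigQJacobi hq0 hq1 hα0 hα1 hβ1 hγ0 hγ
  have hαβ (hβ : 1 < β) : α < α * β := lt_mul_of_one_lt_right hα hβ
  obtain ⟨m, rfl⟩ := Nat.exists_eq_add_of_le' hn
  obtain ⟨x, x', hx, hx', hi, hmem⟩ := h.exists_interlaces (m + 1)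
  have first : γ * q < x 1 := (hmem 1 ⟨le_rfl, by lia⟩).1
  have last : x (m + 2) < α * q := (hmem (m + 2) ⟨by lia, le_rfl⟩).2
  simp only [bigQJacobi_eq_monicPhi, div_mul_eq_mul_div, mul_div_assoc',
    mul_div_cancel_right₀ _ hq0.ne']
  refine ⟨x, x', hx, hx', fun hα' => ?_, fun hβ => ?_, ?_, fun hm hα' hβ => ?_⟩
  · obtain ⟨y, hy, hxy, hyx'⟩ := h.exists_isZeroList_left_shift hα' hx hx' hi
    exact ⟨y, hy, first, hxy, fun j hj => ⟨(hyx' j hj).1, (hi j hj).2⟩⟩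
  · obtain ⟨z, hz, hzx, hzx', hzc⟩ :=
      h.exists_isZeroList_prod_shift (mul_lt_mul_of_pos_right (hαβ hβ) hq0) hx hx' hi
    exact ⟨z, hz, hzc, first, hzx, fun j hj => ⟨(hi j hj).1, (hzx' j hj).2⟩, last⟩
  · obtain ⟨w, hw, hwx, hwx'⟩ := h.exists_isZeroList_right_shift hx hx' hi
    exact ⟨w, hw, hwx, fun j hj => ⟨(hi j hj).1, (hwx' j hj).2⟩, last⟩
  · obtain ⟨k, rfl⟩ := Nat.exists_eq_add_of_le' (show 1 ≤ m by lia)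
    have h' : IsOrthogonalParam q (α * q) (γ * q) (α * β / q * q * q) := by
      rwa [div_mul_cancel₀ _ hq0.ne']
    exact h'.exists_isZeroList_both_shift hα' ((hαβ hβ).trans_eq (div_mul_cancel₀ _ hq0.ne').symm) k

theorem theorem2p4 (n : ℕ) (hn : 2 ≤ n) (q α β γ : ℝ)
    (hq0 : 0 < q) (hq1 : q < 1)
    (hα0 : 0 < α * q) (hα1 : α * q < 1) (hβ0 : 0 < β * q) (hβ1 : β * q < 1) (hγ : γ < 0) :
    ∃ x x' : ℕ → ℝ,
      IsZeroList (bigQJacobi n α β γ q) n x ∧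
      IsZeroList (bigQJacobi (n - 1) α β γ q) (n - 1) x' ∧
      (1 < α → ∃ y : ℕ → ℝ, IsZeroList (bigQJacobi n (α / q) β γ q) n y ∧
        γ * q < x 1 ∧
        (∀ j ∈ Set.Icc 1 n, x j < y j) ∧
        (∀ j ∈ Set.Icc 1 (n - 1), y j < x' j ∧ x' j < x (j + 1))) ∧
      (1 < β → ∃ z : ℕ → ℝ, IsZeroList (bigQJacobi n α (β / q) γ q) n z ∧
        z 1 < γ * q ∧ γ * q < x 1 ∧
        (∀ j ∈ Set.Icc 1 n, z j < x j) ∧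
        (∀ j ∈ Set.Icc 1 (n - 1), x j < x' j ∧ x' j < z (j + 1)) ∧
        x n < α * q) ∧
      (1 < β → ∃ w : ℕ → ℝ, IsZeroList (bigQJacobi n α (β / q) (γ / q) q) n w ∧
        (∀ j ∈ Set.Icc 1 n, w j < x j) ∧
        (∀ j ∈ Set.Icc 1 (n - 1), x j < x' j ∧ x' j < w (j + 1)) ∧
        x n < α * q) ∧
      (3 ≤ n → 1 < α → 1 < β →
        ∃ v : ℕ → ℝ, IsZeroList (bigQJacobi n (α / q) (β / q) γ q) n v ∧ v 1 < γ * q) := by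
  obtain ⟨x, x', hx, hx', hy, hz, hw, hv⟩ := theorem2p4_general n hn q α β γ hq0 hq1 hα0 hα1 hβ1
    hγ.le (hγ.trans (mul_assoc α β q ▸ mul_pos (pos_of_mul_pos_left hα0 hq0.le) hβ0))
  exact ⟨x, x', hx, hx', hy, hz, fun _ => hw, hv⟩
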